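/- Let $k\ge 1$ be a fixed integer and $x>0$ a fixed real number. For positive integers $d$ and $p$ let $|\varphi_s^a\rangle$ ($1\le s\le p$, $1\le a\le k$) be independent random vectors in $\mathbb C^d$, all drawn from one of the following two distributions: the uniform distribution on the unit sphere of $\mathbb C^d$ (normalized ensemble), or the distribution of a vector with independent complex Gaussian coordinates whose real and imaginary parts are independent centered real Gaussians of variance $1/(2d)$ (Gaussian ensemble). Put $$|\varphi_s\rangle=|\varphi_s^1\rangle\otimes\cdots\otimes|\varphi_s^k\rangle\in(\mathbb C^d)^{\otimes k},\qquad M_{p,d,k}=\sum_{s=1}^p|\varphi_s\rangle\langle\varphi_s| ,$$ and let $$\rho_{p,d,k}=\frac1R\sum_{i=1}^R\delta_{\lambda_i}$$ be the empirical distribution of the nonzero eigenvalues $\lambda_1,\dots,\lambda_R$ of $M_{p,d,k}$, counted with multiplicity, where $R=\operatorname{rank}M_{p,d,k}$ ($\rho_{p,d,k}=0$ if $R=0$). Let $d_1<d_2<\cdots$ be positive integers and let $p_1,p_2,\dots$ be nonnegative integers with $p_n/d_n^k\to x$ (for instance $p_n=x\,d_n^k$ exactly, when these numbers are integers). Let the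 matrices $M_{p_n,d_n,k}$, $n\ge1$, all from the same one of the two ensembles, be defined on a common probability space, with an arbitrary joint distribution for different $n$. Then, almost surely, $\rho_{p_n,d_n,k}$ converges weakly, as $n\to\infty$, to the measure on $\mathbb R$ with density $$\lambda\longmapsto\frac{\sqrt{(\lambda_+-\lambda)(\lambda-\lambda_-)}}{2\pi\min(x,1)\,\lambda}\;\mathbf 1_{\{\lambda_-\le\lambda\le\lambda_+\}},\qquad \lambda_\pm=(1\pm\sqrt x)^2 ,$$ that is, to the Marčenko–Pastur law with parameter $x$, restricted to $(0,\infty)$ and normalized to total mass one. (For $x\le 1$ the denominator is $2\pi x\lambda$.) -/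

import Mathlib

open MeasureTheory ProbabilityTheory Filter Topology
open scoped NNReal ENNReal

noncomputable section

namespace RandomProductStates

/-- The uniform probability distribution on the unit sphere of `ℂ^d`
(normalized surface measure), regarded as a measure on `ℂ^d`. -/
def unitVectorLaw (d : ℕ) : Measure (EuclideanSpace ℂ (Fin d)) :=
  (((volume : Measure (EuclideanSpace ℂ (Fin d))).toSphere Set.univ)⁻¹ •
    (volume : Measure (EuclideanSpace ℂ (Fin d))).toSphere).map Subtype.val

/-- The law of a complex number whose real and imaginary parts are independent centered real
Gaussians of variance `v`. -/
def complexGaussianLaw (v : ℝ≥0) : Measure ℂ :=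
  ((gaussianReal 0 v).prod (gaussianReal 0 v)).map (fun z => (⟨z.1, z.2⟩ : ℂ))

/-- The law of a Gaussian vector in `ℂ^d` with i.i.d. coordinates, the real and imaginary part of
each having variance `1 / (2 d)`, so that the expected squared norm is `1`. -/
def gaussianVectorLaw (d : ℕ) : Measure (EuclideanSpace ℂ (Fin d)) :=
  (Measure.pi (fun _ : Fin d => complexGaussianLaw (1 / (2 * (d : ℝ≥0))))).map (WithLp.toLp 2)

/-- The two kinds of random product vectors. -/
inductive Ensemble where
  | normalized : Ensemble
  | gaussian : Ensemble

/-- The distribution of each tensor factor. -/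
def Ensemble.factorLaw : Ensemble → (d : ℕ) → Measure (EuclideanSpace ℂ (Fin d))
  | .normalized, d => unitVectorLaw d
  | .gaussian, d => gaussianVectorLaw d

variable {p d k : ℕ}

/-- The product vector `u 0 ⊗ ⋯ ⊗ u (k - 1)` of `(ℂ^d)^{⊗ k}`, in coordinates with respect to the
product basis, which is indexed by `Fin k → Fin d`. -/
def productVector (u : Fin k → EuclideanSpace ℂ (Fin d)) : (Fin k → Fin d) → ℂ :=
  fun j => ∏ a, u a (j a)

/-- The matrix `∑ s, |φ_s⟩⟨φ_s|` with `φ_s = u s 0 ⊗ ⋯ ⊗ u s (k - 1)`. -/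
def sumOfProjectors (u : Fin p → Fin k → EuclideanSpace ℂ (Fin d)) :
    Matrix (Fin k → Fin d) (Fin k → Fin d) ℂ :=
  ∑ s, Matrix.vecMulVec (productVector (u s)) (star (productVector (u s)))

theorem sumOfProjectors_isHermitian (u : Fin p → Fin k → EuclideanSpace ℂ (Fin d)) :
    (sumOfProjectors u).IsHermitian := by
  unfold sumOfProjectors Matrix.IsHermitian
  rw [Matrix.conjTranspose_sum]
  refine Finset.sum_congr rfl fun s _ => ?_
  ext i j
  simp [Matrix.vecMulVec_apply, mul_comm]

/-- The empirical distribution `(1 / R) ∑ δ_λ` of the nonzero eigenvalues `λ` (counted with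
multiplicity) of a Hermitian matrix of rank `R`; it is the zero measure if `R = 0`. -/
def nonzeroSpectralDistribution {ι : Type*} [Fintype ι] [DecidableEq ι] {A : Matrix ι ι ℂ}
    (hA : A.IsHermitian) : FiniteMeasure ℝ :=
  (A.rank : ℝ≥0)⁻¹ •
    ∑ i with hA.eigenvalues i ≠ 0, (diracProba (hA.eigenvalues i)).toFiniteMeasure

/-- The density of the absolutely continuous part of the Marčenko–Pastur distribution with
parameter `x > 0`, normalized to a probability density. -/
def marchenkoPasturDensity (x t : ℝ) : ℝ :=
  Set.indicator (Set.Icc ((1 - √x) ^ 2) ((1 + √x) ^ 2))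
    (fun t => √(((1 + √x) ^ 2 - t) * (t - (1 - √x) ^ 2)) / (2 * Real.pi * min x 1 * t)) t

theorem marchenkoPasturDensity_lintegral_lt_top (x : ℝ) :
    ∫⁻ t, ENNReal.ofReal (marchenkoPasturDensity x t) < ∞ := by
  set b : ℝ := (1 + √x) ^ 2 with hb
  set c : ℝ := |(2 * Real.pi * min x 1)⁻¹| * √b with hc
  have hb0 : 0 ≤ b := sq_nonneg _
  have hi : IntegrableOn (fun t : ℝ => c * t ^ (-(1 / 2) : ℝ)) (Set.Ioc 0 b) := by
    have h := (intervalIntegral.intervalIntegrable_rpow' (a := 0) (b := b)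
      (r := (-(1 / 2) : ℝ)) (by norm_num)).const_mul c
    exact (intervalIntegrable_iff_integrableOn_Ioc_of_le hb0).1 h
  have hi' := (hi.integrable_indicator measurableSet_Ioc).lintegral_lt_top
  refine lt_of_le_of_lt (lintegral_mono fun t => ENNReal.ofReal_le_ofReal ?_) hi'
  unfold marchenkoPasturDensity
  by_cases ht : t ∈ Set.Icc ((1 - √x) ^ 2) b
  · rw [Set.indicator_of_mem ht]
    have ht0 : 0 ≤ t := (sq_nonneg _).trans ht.1
    rcases ht0.eq_or_lt with h0 | h0
    · subst h0; simp
    · rw [Set.indicator_of_mem (show t ∈ Set.Ioc 0 b from ⟨h0, ht.2⟩)]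
      have h1 : √((b - t) * (t - (1 - √x) ^ 2)) ≤ √b * √t := by
        rw [← Real.sqrt_mul hb0]
        apply Real.sqrt_le_sqrt
        have := sq_nonneg (1 - √x)
        have h2 := ht.1
        have h3 := ht.2
        exact mul_le_mul (by linarith) (by linarith) (by linarith) hb0
      have h4 : t ^ (-(1 / 2) : ℝ) = √t * t⁻¹ := by
        rw [Real.sqrt_eq_rpow, ← Real.rpow_neg_one, ← Real.rpow_add h0]; norm_num
      calc √((b - t) * (t - (1 - √x) ^ 2)) / (2 * Real.pi * min x 1 * t)
          = √((b - t) * (t - (1 - √x) ^ 2)) * (2 * Real.pi * min x 1)⁻¹ * t⁻¹ := by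
            rw [div_eq_mul_inv, mul_inv (2 * Real.pi * min x 1), ← mul_assoc]
        _ ≤ (√b * √t) * |(2 * Real.pi * min x 1)⁻¹| * t⁻¹ := by
            have ht' : 0 ≤ t⁻¹ := inv_nonneg.2 ht0
            refine mul_le_mul_of_nonneg_right ?_ ht'
            exact (mul_le_mul_of_nonneg_left (le_abs_self _) (Real.sqrt_nonneg _)).trans
              (mul_le_mul_of_nonneg_right h1 (abs_nonneg _))
        _ = c * t ^ (-(1 / 2) : ℝ) := by rw [h4, hc]; ring
  · rw [Set.indicator_of_notMem ht]
    exact Set.indicator_nonneg (fun s hs => by have := hs.1; positivity) t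

/-- The limiting distribution, with density `marchenkoPasturDensity x`. -/
def marchenkoPasturLaw (x : ℝ) : FiniteMeasure ℝ :=
  ⟨volume.withDensity fun t => ENNReal.ofReal (marchenkoPasturDensity x t),
    isFiniteMeasure_withDensity (marchenkoPasturDensity_lintegral_lt_top x).ne⟩

end RandomProductStates

end

/-! The proof is the resolvent method at real points `-t`, `t > 0`. Let `N = d ^ k` and let `S(t)`
be the normalized trace of `(M + t)⁻¹`. Since `M + t` is a sum of rank-one terms plus `t`, the
Sherman–Morrison formula (`BoundedBelow.inv_add_vecMulVec`) yields `t S + N⁻¹ ∑ q_s / (1 + q_s) = 1`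
(`stieltjes_identity`), where `q_s` is the quadratic form in the `s`-th vector of the resolvent that
omits this vector.

The `s`-th vector is independent of that resolvent. Although a product vector has only about `k d`
degrees of freedom in dimension `d ^ k`, a quadratic form in it still has variance `O(1 / d)` around
its normalized trace (`quadraticConcentration_productLaw`, by induction on `k`); the single-factor
case uses only unitary invariance and a fourth moment. So `q_s` is close to `S`. Changing one vector
moves `S` by at most `1 / (t N)`, hence McDiarmid's inequality (`measure_abs_sub_ge_le`) keeps `S`
near its mean. Together these give the approximate equation `t m + (p / N) m / (1 + m) = 1` for the
mean (`QuadraticConcentration.abs_mean_equation_le`), which is stable because its left side has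
slope at least `t` (`mul_abs_sub_mpStieltjes_le`). The deviation probabilities are exponentially
small in `N`, and `N ≥ n`, so Borel–Cantelli gives almost sure convergence for every coupling
(`ae_tendsto_stieltjes`).

It remains to remove the zero eigenvalues. Their proportion is at most `t S(t)`, whose limit tends
to `1 - min x 1` as `t → 0`; with the trivial bound `rank ≤ min p N` this fixes the limiting rank
(`tendsto_min_of_one_sub_le`), so the transforms of the nonzero spectra converge as well.
Convergence of the transforms at positive rational `t` implies weak convergence on the half-line, by
polynomial approximation in `(1 + y)⁻¹` (`tendsto_integral_of_tendsto_stieltjes`). -/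

noncomputable section
namespace RandomProductStates
open Matrix

/-! ### Quadratic forms and rank-one perturbations of inverses. -/

section QuadForm
variable {ι : Type*} [Fintype ι]

/-- The real part of the sesquilinear form `v* A v`. -/
def quadForm (A : Matrix ι ι ℂ) (v : ι → ℂ) : ℝ := (star v ⬝ᵥ A *ᵥ v).re

/-- The squared Euclidean norm of a coordinate vector. -/
def normSq (v : ι → ℂ) : ℝ := ∑ i, ‖v i‖ ^ 2

theorem normSq_nonneg (v : ι → ℂ) : 0 ≤ normSq v := Finset.sum_nonneg fun _ _ => sq_nonneg _

theorem star_dotProduct_self (v : ι → ℂ) : star v ⬝ᵥ v = (normSq v : ℂ) := by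
  simp only [dotProduct, Pi.star_apply, normSq, Complex.ofReal_sum]
  refine Finset.sum_congr rfl fun i _ => ?_
  rw [Complex.star_def, Complex.conj_mul']
  push_cast
  rfl

theorem quadForm_add (A B : Matrix ι ι ℂ) (v : ι → ℂ) :
    quadForm (A + B) v = quadForm A v + quadForm B v := by
  simp [quadForm, add_mulVec, dotProduct_add]

theorem quadForm_smul_one [DecidableEq ι] (t : ℝ) (v : ι → ℂ) :
    quadForm ((t : ℂ) • (1 : Matrix ι ι ℂ)) v = t * normSq v := by
  rw [quadForm, smul_mulVec, one_mulVec, dotProduct_smul, star_dotProduct_self, smul_eq_mul,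
    ← Complex.ofReal_mul, Complex.ofReal_re]

theorem quadForm_vecMulVec (u v : ι → ℂ) :
    quadForm (vecMulVec u (star u)) v = ‖star u ⬝ᵥ v‖ ^ 2 := by
  rw [quadForm, vecMulVec_mulVec, dotProduct_smul, MulOpposite.smul_eq_mul_unop,
    MulOpposite.unop_op]
  have : star v ⬝ᵥ u = star (star u ⬝ᵥ v) := by
    rw [star_dotProduct]
  rw [this, Complex.star_def, Complex.conj_mul', ← Complex.ofReal_pow, Complex.ofReal_re]

theorem star_dotProduct_mulVec_eq_quadForm {A : Matrix ι ι ℂ} (hA : A.IsHermitian) (v : ι → ℂ) :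
    star v ⬝ᵥ A *ᵥ v = (quadForm A v : ℂ) := by
  apply Complex.ext
  · simp [quadForm]
  · have := hA.im_star_dotProduct_mulVec_self v
    simpa using this

omit [Fintype ι] in
theorem isHermitian_vecMulVec (u : ι → ℂ) : (vecMulVec u (star u)).IsHermitian := by
  ext i j
  simp [vecMulVec_apply, mul_comm]

/-- Cauchy–Schwarz for coordinate vectors. -/
theorem norm_star_dotProduct_sq_le (u v : ι → ℂ) :
    ‖star u ⬝ᵥ v‖ ^ 2 ≤ normSq u * normSq v := by
  calc ‖star u ⬝ᵥ v‖ ^ 2 ≤ (∑ i, ‖u i‖ * ‖v i‖) ^ 2 := by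
        gcongr
        refine (norm_sum_le _ _).trans (Finset.sum_le_sum fun i _ => ?_)
        simp
    _ ≤ _ := Finset.sum_mul_sq_le_sq_mul_sq _ _ _

variable [DecidableEq ι]

/-- A Hermitian matrix bounded below by `t > 0`. -/
structure BoundedBelow (A : Matrix ι ι ℂ) (t : ℝ) : Prop where
  isHermitian : A.IsHermitian
  le_quadForm : ∀ v, t * normSq v ≤ quadForm A v

namespace BoundedBelow
variable {A : Matrix ι ι ℂ} {t : ℝ}

omit [DecidableEq ι] in
open scoped ComplexOrder in
theorem posDef (h : BoundedBelow A t) (ht : 0 < t) : A.PosDef := by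
  refine PosDef.of_dotProduct_mulVec_pos h.isHermitian fun v hv => ?_
  rw [star_dotProduct_mulVec_eq_quadForm h.isHermitian, Complex.zero_lt_real]
  refine lt_of_lt_of_le ?_ (h.le_quadForm v)
  refine mul_pos ht ?_
  obtain ⟨i, hi⟩ := Function.ne_iff.1 hv
  exact Finset.sum_pos' (fun _ _ => sq_nonneg _) ⟨i, Finset.mem_univ _, by
    have := norm_pos_iff.2 hi; positivity⟩

open scoped ComplexOrder in
theorem isUnit_det (h : BoundedBelow A t) (ht : 0 < t) : IsUnit A.det :=
  (h.posDef ht).det_pos.ne'.isUnit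

theorem mul_inv (h : BoundedBelow A t) (ht : 0 < t) : A * A⁻¹ = 1 :=
  mul_nonsing_inv _ (h.isUnit_det ht)

theorem isHermitian_inv (h : BoundedBelow A t) : (A⁻¹).IsHermitian := h.isHermitian.inv

theorem quadForm_inv (h : BoundedBelow A t) (ht : 0 < t) (v : ι → ℂ) :
    quadForm A⁻¹ v = quadForm A (A⁻¹ *ᵥ v) := by
  rw [quadForm, quadForm, mulVec_mulVec, h.mul_inv ht, one_mulVec, star_mulVec, h.isHermitian_inv.eq,
    dotProduct_mulVec]

theorem mul_normSq_inv_le (h : BoundedBelow A t) (ht : 0 < t) (v : ι → ℂ) :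
    t * normSq (A⁻¹ *ᵥ v) ≤ quadForm A⁻¹ v := by
  rw [h.quadForm_inv ht]; exact h.le_quadForm _

theorem quadForm_inv_nonneg (h : BoundedBelow A t) (ht : 0 < t) (v : ι → ℂ) :
    0 ≤ quadForm A⁻¹ v :=
  (mul_nonneg ht.le (normSq_nonneg _)).trans (h.mul_normSq_inv_le ht v)

/-- With `q` the form on the left, Cauchy–Schwarz and `mul_normSq_inv_le` give `q ^ 2 ≤ normSq v *
(q / t)`; then divide by `q`. -/
theorem quadForm_inv_le (h : BoundedBelow A t) (ht : 0 < t) (v : ι → ℂ) :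
    quadForm A⁻¹ v ≤ t⁻¹ * normSq v := by
  have h1 := h.mul_normSq_inv_le ht v
  have h2 := norm_star_dotProduct_sq_le v (A⁻¹ *ᵥ v)
  rw [star_dotProduct_mulVec_eq_quadForm h.isHermitian_inv, Complex.norm_real, Real.norm_eq_abs,
    sq_abs] at h2
  have h0 := h.quadForm_inv_nonneg ht v
  rcases h0.eq_or_lt with h3 | h3
  · rw [← h3]; exact mul_nonneg (inv_nonneg.2 ht.le) (normSq_nonneg _)
  · rw [inv_mul_eq_div, le_div_iff₀ ht]
    have h4 := normSq_nonneg v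
    refine le_of_mul_le_mul_left ?_ h3
    nlinarith

variable (ψ : ι → ℂ)

/-- The Sherman–Morrison formula. -/
theorem inv_add_vecMulVec (h : BoundedBelow A t) (ht : 0 < t) :
    (A + vecMulVec ψ (star ψ))⁻¹ =
      A⁻¹ - ((1 + quadForm A⁻¹ ψ : ℝ) : ℂ)⁻¹ • vecMulVec (A⁻¹ *ᵥ ψ) (star (A⁻¹ *ᵥ ψ)) := by
  have hq : ((1 + quadForm A⁻¹ ψ : ℝ) : ℂ) ≠ 0 := by
    have := h.quadForm_inv_nonneg ht ψ
    exact_mod_cast (by positivity : (1 + quadForm A⁻¹ ψ) ≠ 0)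
  apply inv_eq_right_inv
  have hs : star (A⁻¹ *ᵥ ψ) = star ψ ᵥ* A⁻¹ := by rw [star_mulVec, h.isHermitian_inv.eq]
  have e1 : A * vecMulVec (A⁻¹ *ᵥ ψ) (star (A⁻¹ *ᵥ ψ)) = vecMulVec ψ (star (A⁻¹ *ᵥ ψ)) := by
    rw [mul_vecMulVec, mulVec_mulVec, h.mul_inv ht, one_mulVec]
  have e2 : vecMulVec ψ (star ψ) * A⁻¹ = vecMulVec ψ (star (A⁻¹ *ᵥ ψ)) := by
    rw [vecMulVec_mul, hs]
  have e3 : vecMulVec ψ (star ψ) * vecMulVec (A⁻¹ *ᵥ ψ) (star (A⁻¹ *ᵥ ψ)) =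
      (quadForm A⁻¹ ψ : ℂ) • vecMulVec ψ (star (A⁻¹ *ᵥ ψ)) := by
    rw [vecMulVec_mul_vecMulVec, star_dotProduct_mulVec_eq_quadForm h.isHermitian_inv]
    ext i j
    simp only [vecMulVec_apply, Matrix.smul_apply, smul_eq_mul, Pi.smul_apply]
    ring
  rw [add_mul, mul_sub, mul_sub, mul_smul_comm, mul_smul_comm, e1, e2, e3, h.mul_inv ht, smul_smul]
  have key : ((1 + quadForm A⁻¹ ψ : ℝ) : ℂ)⁻¹ +
      ((1 + quadForm A⁻¹ ψ : ℝ) : ℂ)⁻¹ * (quadForm A⁻¹ ψ : ℂ) = 1 := by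
    rw [← inv_mul_cancel₀ hq]
    push_cast
    ring
  have := congrArg (fun c : ℂ => c • vecMulVec ψ (star (A⁻¹ *ᵥ ψ))) key
  simp only [add_smul, one_smul] at this
  linear_combination (norm := module) -this

theorem quadForm_inv_add_vecMulVec (h : BoundedBelow A t) (ht : 0 < t) :
    quadForm (A + vecMulVec ψ (star ψ))⁻¹ ψ = quadForm A⁻¹ ψ / (1 + quadForm A⁻¹ ψ) := by
  have hq := h.quadForm_inv_nonneg ht ψ
  rw [h.inv_add_vecMulVec ψ ht, quadForm, sub_mulVec, dotProduct_sub, smul_mulVec,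
    dotProduct_smul, smul_eq_mul, vecMulVec_mulVec, dotProduct_smul, star_mulVec,
    h.isHermitian_inv.eq, MulOpposite.smul_eq_mul_unop, MulOpposite.unop_op, ← dotProduct_mulVec,
    star_dotProduct_mulVec_eq_quadForm h.isHermitian_inv]
  norm_cast
  field_simp
  ring

theorem trace_inv_add_vecMulVec (h : BoundedBelow A t) (ht : 0 < t) :
    (A + vecMulVec ψ (star ψ))⁻¹.trace.re =
      A⁻¹.trace.re - normSq (A⁻¹ *ᵥ ψ) / (1 + quadForm A⁻¹ ψ) := by
  rw [h.inv_add_vecMulVec ψ ht, trace_sub, trace_smul, trace_vecMulVec, dotProduct_comm,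
    star_dotProduct_self, smul_eq_mul, Complex.sub_re]
  norm_cast
  ring

theorem trace_inv_add_vecMulVec_le (h : BoundedBelow A t) (ht : 0 < t) :
    (A + vecMulVec ψ (star ψ))⁻¹.trace.re ≤ A⁻¹.trace.re := by
  rw [h.trace_inv_add_vecMulVec ψ ht]
  have := normSq_nonneg (A⁻¹ *ᵥ ψ)
  have := h.quadForm_inv_nonneg ht ψ
  have : 0 ≤ normSq (A⁻¹ *ᵥ ψ) / (1 + quadForm A⁻¹ ψ) := by positivity
  linarith

/-- The loss of trace is `normSq (A⁻¹ ψ) / (1 + q)` with `normSq (A⁻¹ ψ) ≤ q / t`, hence at most `1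
/ t` however long `ψ` is. This uniformity is what gives unbounded Gaussian vectors bounded
differences. -/
theorem le_trace_inv_add_vecMulVec (h : BoundedBelow A t) (ht : 0 < t) :
    A⁻¹.trace.re - t⁻¹ ≤ (A + vecMulVec ψ (star ψ))⁻¹.trace.re := by
  rw [h.trace_inv_add_vecMulVec ψ ht]
  have h1 := h.mul_normSq_inv_le ht ψ
  have h2 := h.quadForm_inv_nonneg ht ψ
  have : normSq (A⁻¹ *ᵥ ψ) / (1 + quadForm A⁻¹ ψ) ≤ t⁻¹ := by
    rw [div_le_iff₀ (by positivity), inv_mul_eq_div, le_div_iff₀ ht]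
    linarith
  linarith

end BoundedBelow

theorem trace_re_eq_sum_quadForm (A : Matrix ι ι ℂ) :
    A.trace.re = ∑ i, quadForm A (Pi.single i 1) := by
  rw [trace, Complex.re_sum]
  refine Finset.sum_congr rfl fun i _ => ?_
  rw [quadForm, mulVec_single_one, ← Pi.single_star]
  simp

theorem normSq_single (i : ι) : normSq (Pi.single i 1 : ι → ℂ) = 1 := by
  rw [normSq, Finset.sum_eq_single i] <;> simp +contextual

theorem BoundedBelow.trace_inv_nonneg {A : Matrix ι ι ℂ} {t : ℝ} (h : BoundedBelow A t)
    (ht : 0 < t) : 0 ≤ A⁻¹.trace.re := by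
  rw [trace_re_eq_sum_quadForm]
  exact Finset.sum_nonneg fun i _ => h.quadForm_inv_nonneg ht _

theorem BoundedBelow.trace_inv_le {A : Matrix ι ι ℂ} {t : ℝ} (h : BoundedBelow A t)
    (ht : 0 < t) : A⁻¹.trace.re ≤ Fintype.card ι * t⁻¹ := by
  rw [trace_re_eq_sum_quadForm]
  refine (Finset.sum_le_sum fun i _ => h.quadForm_inv_le ht _).trans ?_
  simp [normSq_single]

end QuadForm

/-! ### The resolvent of a sum of rank-one matrices. -/

section Resolvent
variable {ι : Type*} [Fintype ι] [DecidableEq ι] {p : ℕ}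

/-- The matrix `∑ s, |X s⟩⟨X s| + t`. -/
def shiftedGram (X : Fin p → ι → ℂ) (t : ℝ) : Matrix ι ι ℂ :=
  ∑ s, vecMulVec (X s) (star (X s)) + (t : ℂ) • 1

/-- The normalized trace of the resolvent `(∑ s, |X s⟩⟨X s| + t)⁻¹`. -/
def stieltjes (X : Fin p → ι → ℂ) (t : ℝ) : ℝ :=
  (shiftedGram X t)⁻¹.trace.re / Fintype.card ι

theorem boundedBelow_shiftedGram (X : Fin p → ι → ℂ) (t : ℝ) :
    BoundedBelow (shiftedGram X t) t where
  isHermitian := by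
    refine IsHermitian.add ?_ ?_
    · rw [IsHermitian, conjTranspose_sum]
      exact Finset.sum_congr rfl fun s _ => isHermitian_vecMulVec _
    · ext i j
      by_cases hij : i = j <;> simp [hij, eq_comm]
  le_quadForm v := by
    rw [shiftedGram, quadForm_add, quadForm_smul_one, quadForm, sum_mulVec, dotProduct_sum,
      Complex.re_sum]
    refine le_add_of_nonneg_left (Finset.sum_nonneg fun s _ => ?_)
    have := quadForm_vecMulVec (X s) v
    rw [quadForm] at this
    rw [this]; positivity

omit [Fintype ι] in
theorem shiftedGram_succAbove (X : Fin (p + 1) → ι → ℂ) (s : Fin (p + 1)) (t : ℝ) :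
    shiftedGram X t = shiftedGram (s.removeNth X) t + vecMulVec (X s) (star (X s)) := by
  rw [shiftedGram, Fin.sum_univ_succAbove _ s, shiftedGram]
  simp only [Fin.removeNth]
  abel

theorem stieltjes_nonneg (X : Fin p → ι → ℂ) {t : ℝ} (ht : 0 < t) : 0 ≤ stieltjes X t :=
  div_nonneg ((boundedBelow_shiftedGram X t).trace_inv_nonneg ht) (Nat.cast_nonneg _)

theorem stieltjes_le [Nonempty ι] (X : Fin p → ι → ℂ) {t : ℝ} (ht : 0 < t) :
    stieltjes X t ≤ t⁻¹ := by
  have := (boundedBelow_shiftedGram X t).trace_inv_le ht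
  rw [stieltjes, div_le_iff₀ (by exact_mod_cast Fintype.card_pos)]
  linarith

theorem stieltjes_le_removeNth (X : Fin (p + 1) → ι → ℂ) (s : Fin (p + 1)) {t : ℝ} (ht : 0 < t) :
    stieltjes X t ≤ stieltjes (s.removeNth X) t := by
  unfold stieltjes
  rw [shiftedGram_succAbove X s]
  refine div_le_div_of_nonneg_right ?_ (Nat.cast_nonneg _)
  exact (boundedBelow_shiftedGram (s.removeNth X) t).trace_inv_add_vecMulVec_le _ ht

theorem removeNth_le_stieltjes (X : Fin (p + 1) → ι → ℂ) (s : Fin (p + 1)) {t : ℝ} (ht : 0 < t) :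
    stieltjes (s.removeNth X) t - t⁻¹ / Fintype.card ι ≤ stieltjes X t := by
  unfold stieltjes
  rw [shiftedGram_succAbove X s, ← sub_div]
  refine div_le_div_of_nonneg_right ?_ (Nat.cast_nonneg _)
  exact (boundedBelow_shiftedGram (s.removeNth X) t).le_trace_inv_add_vecMulVec _ ht

/-- The defining identity `t tr G + ∑ s, ⟨X s| G |X s⟩ = N` of the resolvent, with each term
expressed through the resolvent that omits the `s`-th vector. -/
theorem stieltjes_identity [Nonempty ι] (X : Fin (p + 1) → ι → ℂ) {t : ℝ} (ht : 0 < t) :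
    t * stieltjes X t + (∑ s, quadForm (shiftedGram (s.removeNth X) t)⁻¹ (X s) /
      (1 + quadForm (shiftedGram (s.removeNth X) t)⁻¹ (X s))) / Fintype.card ι = 1 := by
  have hc : (Fintype.card ι : ℝ) ≠ 0 := by exact_mod_cast Fintype.card_ne_zero
  have h := boundedBelow_shiftedGram X t
  have h1 : ∀ s, quadForm (shiftedGram (s.removeNth X) t)⁻¹ (X s) /
      (1 + quadForm (shiftedGram (s.removeNth X) t)⁻¹ (X s)) =
      quadForm (shiftedGram X t)⁻¹ (X s) := fun s => by
    rw [shiftedGram_succAbove X s,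
      (boundedBelow_shiftedGram _ t).quadForm_inv_add_vecMulVec _ ht]
  have h2 : ∀ s, quadForm (shiftedGram X t)⁻¹ (X s) =
      (vecMulVec (X s) (star (X s)) * (shiftedGram X t)⁻¹).trace.re := fun s => by
    rw [vecMulVec_mul, trace_vecMulVec, dotProduct_comm, ← dotProduct_mulVec, quadForm]
  have h3 : t * (shiftedGram X t)⁻¹.trace.re =
      (((t : ℂ) • (1 : Matrix ι ι ℂ)) * (shiftedGram X t)⁻¹).trace.re := by
    simp [trace_smul]
  -- The identity is the trace of `(∑ |X s⟩⟨X s| + t) G = 1`, split into its summands.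
  have h4 := congrArg (fun A : Matrix ι ι ℂ => A.trace.re) (h.mul_inv ht)
  simp only [trace_one] at h4
  nth_rw 1 [shiftedGram] at h4
  rw [add_mul, trace_add, Complex.add_re, ← h3, Finset.sum_mul, trace_sum, Complex.re_sum] at h4
  simp_rw [h1, h2]
  rw [stieltjes]
  field_simp
  rw [Complex.natCast_re] at h4
  linarith

theorem trace_inv_add_smul_one {A : Matrix ι ι ℂ} (hA : A.IsHermitian) {t : ℝ}
    (h : ∀ i, hA.eigenvalues i + t ≠ 0) :
    (A + (t : ℂ) • 1)⁻¹.trace.re = ∑ i, (hA.eigenvalues i + t)⁻¹ := by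
  have h1 : (A + (t : ℂ) • 1)⁻¹ = Unitary.conjStarAlgAut ℂ _ hA.eigenvectorUnitary
      (diagonal fun i => (((hA.eigenvalues i + t)⁻¹ : ℝ) : ℂ)) := by
    apply inv_eq_right_inv
    nth_rw 1 [hA.spectral_theorem]
    rw [← map_one (Unitary.conjStarAlgAut ℂ _ hA.eigenvectorUnitary), ← map_smul, ← map_add,
      ← map_mul, smul_one_eq_diagonal, diagonal_add, diagonal_mul_diagonal, ← diagonal_one]
    congr 2
    funext i
    have := h i
    simp only [Function.comp_apply, RCLike.ofReal_eq_complex_ofReal]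
    rw [← Complex.ofReal_add, ← Complex.ofReal_mul, mul_inv_cancel₀ this, Complex.ofReal_one]
  rw [h1, Unitary.conjStarAlgAut_apply, trace_mul_cycle, Unitary.coe_star_mul_self, one_mul,
    trace_diagonal, Complex.re_sum]
  simp only [Complex.ofReal_re]

end Resolvent
end RandomProductStates
end

noncomputable section
namespace RandomProductStates
open Matrix

/-! ### Moments of unitarily invariant laws. -/

section Invariant
variable {d : ℕ}

theorem norm_sq_eq_normSq (u : EuclideanSpace ℂ (Fin d)) : ‖u‖ ^ 2 = normSq u.ofLp :=
  EuclideanSpace.norm_sq_eq u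

/-- Summing `‖a + w b‖ ^ 4` over the fourth roots of unity `w` cancels every term that depends on
the relative phase of `a` and `b`. -/
theorem sum_norm_add_pow_four (a b : ℂ) :
    ‖a + b‖ ^ 4 + ‖a - b‖ ^ 4 + ‖a + Complex.I * b‖ ^ 4 + ‖a - Complex.I * b‖ ^ 4 =
      4 * ‖a‖ ^ 4 + 4 * ‖b‖ ^ 4 + 16 * (‖a‖ ^ 2 * ‖b‖ ^ 2) := by
  have h : ∀ z : ℂ, ‖z‖ ^ 4 = (z.re * z.re + z.im * z.im) ^ 2 := fun z => by
    rw [← Complex.normSq_apply, ← Complex.sq_norm]; ring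
  have h' : ∀ z : ℂ, ‖z‖ ^ 2 = z.re * z.re + z.im * z.im := fun z => by
    rw [← Complex.normSq_apply, ← Complex.sq_norm]
  simp only [h, h', Complex.add_re, Complex.add_im, Complex.sub_re, Complex.sub_im, Complex.mul_re,
    Complex.mul_im, Complex.I_re, Complex.I_im]
  ring

/-- A probability measure on `ℂ^d` that is invariant under the unitary group and has a finite
fourth moment. -/
structure UnitarilyInvariant (P : Measure (EuclideanSpace ℂ (Fin d))) : Prop where
  isProbabilityMeasure : IsProbabilityMeasure P
  map_eq : ∀ L : EuclideanSpace ℂ (Fin d) ≃ₗᵢ[ℂ] EuclideanSpace ℂ (Fin d), P.map L = P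
  integrable : Integrable (fun u => ‖u‖ ^ 4) P

namespace UnitarilyInvariant
variable {P : Measure (EuclideanSpace ℂ (Fin d))}

theorem integral_comp (h : UnitarilyInvariant P)
    (L : EuclideanSpace ℂ (Fin d) ≃ₗᵢ[ℂ] EuclideanSpace ℂ (Fin d))
    (f : EuclideanSpace ℂ (Fin d) → ℝ) : ∫ u, f (L u) ∂P = ∫ u, f u ∂P := by
  have hL : MeasurableEmbedding L := L.toHomeomorph.measurableEmbedding
  conv_rhs => rw [← h.map_eq L, hL.integral_map]

/-- Extend `b` to an orthonormal basis with `b` in position `i`; passing to coordinates in that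
basis is unitary. -/
theorem integral_inner_congr (h : UnitarilyInvariant P) (f : ℂ → ℝ) (i : Fin d)
    {b : EuclideanSpace ℂ (Fin d)} (hb : ‖b‖ = 1) :
    ∫ u, f (inner ℂ b u) ∂P = ∫ u, f (u i) ∂P := by
  have ho : Orthonormal ℂ (({i} : Set (Fin d)).domRestrict fun _ => b) := by
    constructor
    · intro; exact hb
    · intro j k hjk; exact (hjk (Subsingleton.elim _ _)).elim
  obtain ⟨B, hB⟩ := ho.exists_orthonormalBasis_extension_of_card_eq (by simp)
  rw [← h.integral_comp B.repr fun u => f (u i)]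
  simp only [B.repr_apply_apply, hB i rfl]

theorem integral_coord_congr (h : UnitarilyInvariant P) (f : ℂ → ℝ) (i j : Fin d) :
    ∫ u, f (u i) ∂P = ∫ u, f (u j) ∂P := by
  rw [← h.integral_inner_congr f j (b := EuclideanSpace.single i 1) (by simp)]
  simp [EuclideanSpace.inner_single_left]

theorem integrable_of_le (h : UnitarilyInvariant P) {f : EuclideanSpace ℂ (Fin d) → ℝ}
    (hf : Continuous f) (C : ℝ) (hle : ∀ u, |f u| ≤ C * (1 + ‖u‖ ^ 4)) : Integrable f P := by
  have := h.isProbabilityMeasure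
  refine Integrable.mono' (((integrable_const (1 : ℝ)).add h.integrable).const_mul C)
    hf.aestronglyMeasurable (ae_of_all _ fun u => ?_)
  exact hle u

theorem norm_coord_le (u : EuclideanSpace ℂ (Fin d)) (i : Fin d) : ‖u i‖ ≤ ‖u‖ :=
  PiLp.norm_apply_le u i

theorem integrable_coord_sq_mul (h : UnitarilyInvariant P) (i j : Fin d) :
    Integrable (fun u : EuclideanSpace ℂ (Fin d) => ‖u i‖ ^ 2 * ‖u j‖ ^ 2) P := by
  refine h.integrable_of_le (by fun_prop) 1 fun u => ?_
  rw [abs_of_nonneg (by positivity)]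
  calc ‖u i‖ ^ 2 * ‖u j‖ ^ 2 ≤ ‖u‖ ^ 2 * ‖u‖ ^ 2 := by
        gcongr <;> exact norm_coord_le _ _
    _ ≤ _ := by nlinarith

theorem integrable_norm_sq (h : UnitarilyInvariant P) :
    Integrable (fun u : EuclideanSpace ℂ (Fin d) => ‖u‖ ^ 2) P := by
  refine h.integrable_of_le (by fun_prop) 1 fun u => ?_
  rw [abs_of_nonneg (by positivity)]
  nlinarith [sq_nonneg (‖u‖ ^ 2 - 1)]

theorem integrable_coord_sq (h : UnitarilyInvariant P) (i : Fin d) :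
    Integrable (fun u : EuclideanSpace ℂ (Fin d) => ‖u i‖ ^ 2) P := by
  refine h.integrable_norm_sq.mono' (by fun_prop) (ae_of_all _ fun u => ?_)
  rw [Real.norm_of_nonneg (by positivity)]
  gcongr
  exact norm_coord_le _ _

theorem integral_coord_sq (h : UnitarilyInvariant P) (h2 : ∫ u, ‖u‖ ^ 2 ∂P = 1) (i : Fin d) :
    ∫ u, ‖u i‖ ^ 2 ∂P = 1 / d := by
  simp_rw [EuclideanSpace.norm_sq_eq] at h2
  rw [integral_finsetSum _ fun j _ => h.integrable_coord_sq j] at h2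
  rw [Finset.sum_congr rfl fun j _ => h.integral_coord_congr (fun z => ‖z‖ ^ 2) j i] at h2
  have hd : (d : ℝ) ≠ 0 := by
    have := i.pos
    positivity
  simp only [Finset.sum_const, Finset.card_univ, Fintype.card_fin, nsmul_eq_mul] at h2
  field_simp
  linarith

/-- For a unitarily invariant law, `E |u_i|⁴ = 2 E |u_i|² |u_j|²` for `i ≠ j`. -/
theorem integral_pow_four_eq (h : UnitarilyInvariant P) {i j : Fin d} (hij : i ≠ j) :
    ∫ u, ‖u i‖ ^ 4 ∂P = 2 * ∫ u, ‖u i‖ ^ 2 * ‖u j‖ ^ 2 ∂P := by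
  have key : ∀ w : ℂ, ‖w‖ = 1 → ∫ u, ‖u i + w * u j‖ ^ 4 ∂P = 4 * ∫ u, ‖u i‖ ^ 4 ∂P := by
    intro w hw
    -- The unit vector `b` is chosen so that `⟨b, u⟩ = (u_i + w u_j) / √2`; the conjugate of `w`
    -- appears because the inner product is antilinear in its first argument.
    set b : EuclideanSpace ℂ (Fin d) := ((√2 : ℝ) : ℂ)⁻¹ •
      (EuclideanSpace.single i 1 + EuclideanSpace.single j (star w)) with hb
    have hs : (√2 : ℝ) ≠ 0 := by positivity
    have hn : ‖b‖ = 1 := by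
      have h0 : inner ℂ (EuclideanSpace.single i (1 : ℂ)) (EuclideanSpace.single j (star w)) = 0 := by
        rw [EuclideanSpace.inner_single_left]; simp [hij]
      have := norm_add_sq_eq_norm_sq_add_norm_sq_of_inner_eq_zero _ _ h0
      have h1 : ‖(EuclideanSpace.single i 1 + EuclideanSpace.single j (star w) :
          EuclideanSpace ℂ (Fin d))‖ ^ 2 = 2 := by
        rw [sq, this]; simp [hw]; norm_num
      rw [hb, norm_smul, norm_inv, Complex.norm_real, Real.norm_of_nonneg (by positivity),
        ← Real.sqrt_sq (norm_nonneg (_ + _)), h1, inv_mul_cancel₀ hs]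
    have h1 := h.integral_inner_congr (fun z => ‖z‖ ^ 4) i hn
    have h2 : ∀ u : EuclideanSpace ℂ (Fin d), ‖inner ℂ b u‖ ^ 4 = 1 / 4 * ‖u i + w * u j‖ ^ 4 := by
      intro u
      have : inner ℂ b u = ((√2 : ℝ) : ℂ)⁻¹ * (u i + w * u j) := by
        rw [hb, inner_smul_left, inner_add_left, EuclideanSpace.inner_single_left,
          EuclideanSpace.inner_single_left]
        simp
      rw [this, norm_mul, mul_pow, norm_inv, Complex.norm_real,
        Real.norm_of_nonneg (by positivity), inv_pow,
        show (√2 : ℝ) ^ 4 = (√2 ^ 2) ^ 2 by ring, Real.sq_sqrt (by norm_num)]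
      norm_num
    simp_rw [h2] at h1
    rw [integral_const_mul] at h1
    linarith
  have hi : ∀ w : ℂ, ‖w‖ = 1 →
      Integrable (fun u : EuclideanSpace ℂ (Fin d) => ‖u i + w * u j‖ ^ 4) P := by
    intro w hw
    refine h.integrable_of_le (by fun_prop) 16 fun u => ?_
    rw [abs_of_nonneg (by positivity)]
    calc ‖u i + w * u j‖ ^ 4 ≤ (‖u‖ + ‖u‖) ^ 4 := by
          gcongr
          refine (norm_add_le _ _).trans ?_
          rw [norm_mul, hw, one_mul]
          exact add_le_add (norm_coord_le _ _) (norm_coord_le _ _)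
      _ ≤ _ := by nlinarith
  have hii : ∀ k, Integrable (fun u : EuclideanSpace ℂ (Fin d) => ‖u k‖ ^ 4) P := fun k => by
    simpa only [← pow_add] using h.integrable_coord_sq_mul k k
  have e1 := key 1 (by simp)
  have e2 := key (-1) (by simp)
  have e3 := key Complex.I (by simp)
  have e4 := key (-Complex.I) (by simp)
  have i1 := hi 1 (by simp)
  have i2 := hi (-1) (by simp)
  have i3 := hi Complex.I (by simp)
  have i4 := hi (-Complex.I) (by simp)
  simp only [one_mul, neg_mul, ← sub_eq_add_neg] at *
  -- Adding the four cases `w = ±1, ±I` of `key` gives `16 E|u_i|⁴ = 8 E|u_i|⁴ + 16 E|u_i|²|u_j|²`.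
  have e := integral_congr_ae (μ := P) (ae_of_all _ fun u : EuclideanSpace ℂ (Fin d) =>
    sum_norm_add_pow_four (u i) (u j))
  simp only at e
  rw [integral_add ((i1.fun_add i2).fun_add i3) i4, integral_add (i1.fun_add i2) i3, integral_add i1 i2,
    integral_add (((hii i).const_mul 4).fun_add ((hii j).const_mul 4))
      ((h.integrable_coord_sq_mul i j).const_mul 16),
    integral_add ((hii i).const_mul 4) ((hii j).const_mul 4), integral_const_mul,
    integral_const_mul, integral_const_mul, e1, e2, e3, e4,
    h.integral_coord_congr (fun z => ‖z‖ ^ 4) j i] at e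
  linarith

theorem integral_coord_sq_mul (h : UnitarilyInvariant P) (i j k : Fin d) :
    ∫ u, ‖u i‖ ^ 2 * ‖u j‖ ^ 2 ∂P = (∫ u, ‖u k‖ ^ 4 ∂P) / 2 * (1 + if i = j then 1 else 0) := by
  rw [h.integral_coord_congr (fun z => ‖z‖ ^ 4) k i]
  split_ifs with hij
  · subst hij
    simp only [← pow_add]; norm_num
  · rw [h.integral_pow_four_eq hij]; ring

/-- The second moment of a diagonal quadratic form. -/
theorem integral_sum_mul_sq (h : UnitarilyInvariant P) (c : Fin d → ℝ) (k : Fin d) :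
    Integrable (fun u : EuclideanSpace ℂ (Fin d) => (∑ i, c i * ‖u i‖ ^ 2) ^ 2) P ∧
    ∫ u, (∑ i, c i * ‖u i‖ ^ 2) ^ 2 ∂P =
      (∫ u, ‖u k‖ ^ 4 ∂P) / 2 * ((∑ i, c i) ^ 2 + ∑ i, c i ^ 2) := by
  have e : ∀ u : EuclideanSpace ℂ (Fin d), (∑ i, c i * ‖u i‖ ^ 2) ^ 2 =
      ∑ i, ∑ j, c i * c j * (‖u i‖ ^ 2 * ‖u j‖ ^ 2) := fun u => by
    rw [sq, Finset.sum_mul_sum]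
    exact Finset.sum_congr rfl fun i _ => Finset.sum_congr rfl fun j _ => by ring
  simp_rw [e]
  have hi := fun i j => (h.integrable_coord_sq_mul i j).const_mul (c i * c j)
  refine ⟨integrable_finsetSum _ fun i _ => integrable_finsetSum _ fun j _ => hi i j, ?_⟩
  rw [integral_finsetSum _ fun i _ => integrable_finsetSum _ fun j _ => hi i j]
  simp_rw [integral_finsetSum _ fun j _ => hi _ j, integral_const_mul,
    h.integral_coord_sq_mul _ _ k]
  rw [sq, Finset.sum_mul_sum, ← Finset.sum_add_distrib, Finset.mul_sum]
  refine Finset.sum_congr rfl fun i _ => ?_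
  simp only [mul_add, mul_one, Finset.sum_add_distrib, mul_ite, mul_zero, Finset.sum_ite_eq,
    Finset.mem_univ, if_true, Finset.mul_sum]
  congr 1
  · exact Finset.sum_congr rfl fun j _ => by ring
  · ring

theorem integral_norm_pow_four (h : UnitarilyInvariant P) (k : Fin d) :
    ∫ u, ‖u‖ ^ 4 ∂P = (∫ u, ‖u k‖ ^ 4 ∂P) / 2 * (d ^ 2 + d) := by
  have := (h.integral_sum_mul_sq (fun _ => 1) k).2
  simp only [one_mul, ← EuclideanSpace.norm_sq_eq, ← pow_mul] at this
  simpa using this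

end UnitarilyInvariant
end Invariant

/-! ### Variance of a quadratic form in one factor. -/

section Concentration
variable {d : ℕ}

theorem quadForm_eq_sum_eigenvalues {A : Matrix (Fin d) (Fin d) ℂ} (hA : A.IsHermitian)
    (u : EuclideanSpace ℂ (Fin d)) :
    quadForm A u.ofLp = ∑ i, hA.eigenvalues i * ‖hA.eigenvectorBasis.repr u i‖ ^ 2 := by
  set U : Matrix (Fin d) (Fin d) ℂ := hA.eigenvectorUnitary.1 with hU
  have h1 : ∀ i, (star U *ᵥ u.ofLp) i = hA.eigenvectorBasis.repr u i := fun i => by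
    rw [OrthonormalBasis.repr_apply_apply, EuclideanSpace.inner_eq_star_dotProduct, mulVec,
      dotProduct_comm]
    congr 1
  have h2 : A = U * diagonal (fun i => (hA.eigenvalues i : ℂ)) * star U := by
    conv_lhs => rw [hA.spectral_theorem, Unitary.conjStarAlgAut_apply]
    rfl
  rw [quadForm]
  nth_rw 1 [h2]
  rw [← mulVec_mulVec, ← mulVec_mulVec, dotProduct_mulVec,
    show star u.ofLp ᵥ* U = star (star U *ᵥ u.ofLp) by
      rw [star_mulVec, star_eq_conjTranspose, conjTranspose_conjTranspose],
    dotProduct, Complex.re_sum]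
  refine Finset.sum_congr rfl fun i _ => ?_
  rw [mulVec_diagonal, Pi.star_apply, h1, mul_left_comm, Complex.star_def, Complex.conj_mul',
    ← Complex.ofReal_pow, ← Complex.ofReal_mul, Complex.ofReal_re]

/-- The moment properties of the law of a single tensor factor. -/
structure FactorLaw (P : Measure (EuclideanSpace ℂ (Fin d))) : Prop extends
    UnitarilyInvariant P where
  integral_norm_sq : ∫ u, ‖u‖ ^ 2 ∂P = 1
  integral_coord_pow_four_le : ∀ i, ∫ u, ‖u i‖ ^ 4 ∂P ≤ 2 / d ^ 2

theorem FactorLaw.integral_norm_pow_four_le {P : Measure (EuclideanSpace ℂ (Fin d))}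
    (h : FactorLaw P) (hd : 1 ≤ d) : ∫ u, ‖u‖ ^ 4 ∂P ≤ 2 := by
  have hd' : (1 : ℝ) ≤ d := by exact_mod_cast hd
  rw [h.integral_norm_pow_four ⟨0, hd⟩]
  calc _ ≤ (2 / d ^ 2) / 2 * ((d : ℝ) ^ 2 + d) := by
        gcongr; exact h.integral_coord_pow_four_le _
    _ ≤ 2 := by
        rw [div_div, div_mul_eq_mul_div, div_le_iff₀ (by positivity)]
        nlinarith

/-- A Hermitian matrix whose quadratic form is bounded by `C` times the squared norm. -/
structure FormBounded {ι : Type*} [Fintype ι] (A : Matrix ι ι ℂ) (C : ℝ) : Prop where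
  isHermitian : A.IsHermitian
  abs_quadForm_le : ∀ v, |quadForm A v| ≤ C * normSq v

/-- The variance of a quadratic form in one random vector. -/
theorem FactorLaw.variance_quadForm_le {P : Measure (EuclideanSpace ℂ (Fin d))} (h : FactorLaw P)
    (hd : 1 ≤ d) {A : Matrix (Fin d) (Fin d) ℂ} {C : ℝ} (hA : FormBounded A C) :
    Integrable (fun u : EuclideanSpace ℂ (Fin d) => (quadForm A u.ofLp - A.trace.re / d) ^ 2) P ∧
    ∫ u, (quadForm A u.ofLp - A.trace.re / d) ^ 2 ∂P ≤ C ^ 2 / d := by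
  have := h.isProbabilityMeasure
  have hd' : (0 : ℝ) < d := by exact_mod_cast hd
  set c := hA.1.eigenvalues with hc
  have htr : A.trace.re = ∑ i, c i := by
    rw [hA.1.trace_eq_sum_eigenvalues]; simp [hc]
  have hcC : ∀ i, |c i| ≤ C := fun i => by
    have := hA.2 (hA.1.eigenvectorBasis i).ofLp
    rw [quadForm_eq_sum_eigenvalues hA.1, ← norm_sq_eq_normSq, Finset.sum_eq_single i] at this
    · simpa [hc] using this
    · intro j _ hj
      simp [hj]
    · simp
  -- In an eigenbasis of `A` the form is diagonal, and the change of basis does not alter the law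
  -- `P`.
  have hq : ∀ u : EuclideanSpace ℂ (Fin d), (quadForm A u.ofLp - A.trace.re / d) ^ 2 =
      (fun w : EuclideanSpace ℂ (Fin d) => (∑ i, c i * ‖w i‖ ^ 2 - (∑ i, c i) / d) ^ 2)
        (hA.1.eigenvectorBasis.repr u) := fun u => by
    rw [quadForm_eq_sum_eigenvalues hA.1, htr]
  have hL : MeasurableEmbedding hA.1.eigenvectorBasis.repr :=
    hA.1.eigenvectorBasis.repr.toHomeomorph.measurableEmbedding
  have i1 := (h.integral_sum_mul_sq c ⟨0, hd⟩).1
  have i2 : Integrable (fun w : EuclideanSpace ℂ (Fin d) => ∑ i, c i * ‖w i‖ ^ 2) P :=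
    integrable_finsetSum _ fun i _ => (h.integrable_coord_sq i).const_mul _
  have hexp : ∀ w : EuclideanSpace ℂ (Fin d), (∑ i, c i * ‖w i‖ ^ 2 - (∑ i, c i) / d) ^ 2 =
      (∑ i, c i * ‖w i‖ ^ 2) ^ 2 - 2 * ((∑ i, c i) / d) * (∑ i, c i * ‖w i‖ ^ 2) +
      ((∑ i, c i) / d) ^ 2 := fun w => by ring
  have hint : Integrable (fun w : EuclideanSpace ℂ (Fin d) =>
      (∑ i, c i * ‖w i‖ ^ 2 - (∑ i, c i) / d) ^ 2) P := by
    simp_rw [hexp]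
    exact (i1.sub (i2.const_mul _)).add (integrable_const _)
  constructor
  · simp_rw [hq]
    have := hint
    rw [← h.map_eq hA.1.eigenvectorBasis.repr, hL.integrable_map_iff] at this
    exact this
  · simp_rw [hq]
    refine (h.integral_comp hA.1.eigenvectorBasis.repr
      fun w => (∑ i, c i * ‖w i‖ ^ 2 - (∑ i, c i) / d) ^ 2).trans_le ?_
    simp_rw [hexp]
    have i3 : Integrable (fun w : EuclideanSpace ℂ (Fin d) => (∑ i, c i * ‖w i‖ ^ 2) ^ 2 -
        2 * ((∑ i, c i) / d) * (∑ i, c i * ‖w i‖ ^ 2)) P := i1.sub (i2.const_mul _)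
    rw [integral_add i3 (integrable_const _),
      integral_sub i1 (i2.const_mul _), (h.integral_sum_mul_sq c ⟨0, hd⟩).2, integral_const_mul,
      integral_finsetSum _ fun i _ => (h.integrable_coord_sq i).const_mul _]
    simp_rw [integral_const_mul, h.integral_coord_sq h.integral_norm_sq]
    rw [← Finset.sum_mul]
    have hs : ∑ i, c i ^ 2 ≤ d * C ^ 2 := by
      calc ∑ i, c i ^ 2 ≤ ∑ _i : Fin d, C ^ 2 := Finset.sum_le_sum fun i _ => by
            rw [← sq_abs]; exact pow_le_pow_left₀ (abs_nonneg _) (hcC i) 2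
        _ = _ := by simp
    have hs0 : 0 ≤ ∑ i, c i ^ 2 := Finset.sum_nonneg fun i _ => sq_nonneg _
    have h4 := h.integral_coord_pow_four_le ⟨0, hd⟩
    -- The fourth-moment bound `2 / d ^ 2` is exactly what makes the three multiples of `(∑ c i) ^ 2
    -- / d ^ 2`, namely `1 - 2 + 1`, cancel. A larger constant would leave a term of order one.
    calc _ ≤ (2 / d ^ 2) / 2 * ((∑ i, c i) ^ 2 + ∑ i, c i ^ 2) -
          2 * ((∑ i, c i) / d) * ((∑ i, c i) * (1 / d)) + ((∑ i, c i) / d) ^ 2 := by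
          simp only [integral_const, probReal_univ, one_smul]
          gcongr
      _ = (∑ i, c i ^ 2) / d ^ 2 := by field_simp; ring
      _ ≤ (d * C ^ 2) / d ^ 2 := by gcongr
      _ = C ^ 2 / d := by field_simp

end Concentration
end RandomProductStates
end

noncomputable section
namespace RandomProductStates
open Matrix

/-! ### The uniform law on the unit sphere. -/

section Sphere
variable {d : ℕ}
open scoped Pointwise

theorem map_val_toSphere_apply {S : Set (EuclideanSpace ℂ (Fin d))} (hS : MeasurableSet S) :
    ((volume : Measure (EuclideanSpace ℂ (Fin d))).toSphere.map Subtype.val) S =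
      Module.finrank ℝ (EuclideanSpace ℂ (Fin d)) *
        volume (Set.Ioo (0 : ℝ) 1 • (S ∩ Metric.sphere 0 1)) := by
  rw [Measure.map_apply measurable_subtype_coe hS,
    Measure.toSphere_apply' _ (measurable_subtype_coe hS), Subtype.image_preimage_coe,
    Set.inter_comm]

/-- Up to the dimension factor, the surface measure of a set is the volume of the cone over it. A
unitary map, viewed as a real isometry, preserves volume and carries cones to cones. -/
theorem map_val_toSphere_map (L : EuclideanSpace ℂ (Fin d) ≃ₗᵢ[ℂ] EuclideanSpace ℂ (Fin d)) :
    ((volume : Measure (EuclideanSpace ℂ (Fin d))).toSphere.map Subtype.val).map L =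
      (volume : Measure (EuclideanSpace ℂ (Fin d))).toSphere.map Subtype.val := by
  have hL : Measurable L := L.continuous.measurable
  ext S hS
  rw [Measure.map_apply hL hS, map_val_toSphere_apply (hL hS), map_val_toSphere_apply hS]
  congr 1
  let L' : EuclideanSpace ℂ (Fin d) ≃ₗᵢ[ℝ] EuclideanSpace ℂ (Fin d) :=
    { toLinearEquiv := L.toLinearEquiv.restrictScalars ℝ
      norm_map' := L.norm_map }
  have hv := L'.measurePreserving
  have hemb : MeasurableEmbedding L' := L'.toHomeomorph.measurableEmbedding
  refine Eq.trans ?_ (hv.measure_preimage_emb hemb _)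
  congr 1
  ext v
  simp only [Set.mem_smul, Set.mem_inter_iff, Set.mem_preimage, mem_sphere_iff_norm, sub_zero]
  constructor
  · rintro ⟨r, hr, w, ⟨hw, hn⟩, rfl⟩
    exact ⟨r, hr, L' w, ⟨hw, by rw [L'.norm_map]; exact hn⟩, (map_smul L' r w).symm⟩
  · rintro ⟨r, hr, w, ⟨hw, hn⟩, h⟩
    refine ⟨r, hr, L'.symm w, ⟨?_, by rw [L'.symm.norm_map]; exact hn⟩, ?_⟩
    · have : L (L'.symm w) = w := L'.apply_symm_apply w
      rw [this]; exact hw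
    · rw [← map_smul, h, L'.symm_apply_apply]

theorem toSphere_univ_ne_zero (hd : 1 ≤ d) :
    (volume : Measure (EuclideanSpace ℂ (Fin d))).toSphere Set.univ ≠ 0 := by
  have : Nonempty (Fin d) := ⟨⟨0, hd⟩⟩
  rw [Ne, Measure.measure_univ_eq_zero]
  exact Measure.toSphere_ne_zero _

theorem isProbabilityMeasure_unitVectorLaw (hd : 1 ≤ d) :
    IsProbabilityMeasure (unitVectorLaw d) := by
  unfold unitVectorLaw
  have : IsProbabilityMeasure (((volume : Measure (EuclideanSpace ℂ (Fin d))).toSphere Set.univ)⁻¹ •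
    (volume : Measure (EuclideanSpace ℂ (Fin d))).toSphere) :=
    ⟨by
      rw [Measure.smul_apply, smul_eq_mul]
      exact ENNReal.inv_mul_cancel (toSphere_univ_ne_zero hd) (measure_ne_top _ _)⟩
  exact Measure.isProbabilityMeasure_map measurable_subtype_coe.aemeasurable

theorem ae_norm_eq_one_unitVectorLaw : ∀ᵐ u ∂(unitVectorLaw d), ‖u‖ = 1 := by
  rw [unitVectorLaw, ae_map_iff measurable_subtype_coe.aemeasurable
    (measurableSet_eq_fun measurable_norm measurable_const)]
  exact ae_of_all _ fun u => by simp

theorem factorLaw_unitVectorLaw (hd : 1 ≤ d) : FactorLaw (unitVectorLaw d) := by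
  have hp := isProbabilityMeasure_unitVectorLaw hd
  have hn := ae_norm_eq_one_unitVectorLaw (d := d)
  have h4 : (fun u : EuclideanSpace ℂ (Fin d) => ‖u‖ ^ 4) =ᵐ[unitVectorLaw d] fun _ => 1 := by
    filter_upwards [hn] with u hu
    rw [hu, one_pow]
  have hU : UnitarilyInvariant (unitVectorLaw d) :=
    { isProbabilityMeasure := hp
      map_eq := fun L => by
        rw [unitVectorLaw, Measure.map_smul, Measure.map_smul, map_val_toSphere_map]
      integrable := (integrable_const (1 : ℝ)).congr h4.symm }
  refine ⟨hU, ?_, fun i => ?_⟩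
  · have : (fun u : EuclideanSpace ℂ (Fin d) => ‖u‖ ^ 2) =ᵐ[unitVectorLaw d] fun _ => 1 := by
      filter_upwards [hn] with u hu
      rw [hu, one_pow]
    rw [integral_congr_ae this]
    simp
  -- As `‖u‖ = 1`, this identity determines `E|u_i|⁴ = 2 / (d (d + 1))`.
  · have h := hU.integral_norm_pow_four i
    rw [integral_congr_ae h4] at h
    simp only [integral_const, probReal_univ, smul_eq_mul, mul_one] at h
    have hd' : (0 : ℝ) < d := by exact_mod_cast hd
    rw [le_div_iff₀ (by positivity)]
    have : 0 ≤ ∫ u, ‖u i‖ ^ 4 ∂(unitVectorLaw d) := integral_nonneg fun u => by positivity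
    nlinarith

end Sphere

/-! ### The Gaussian law. -/

section Gaussian
variable {d : ℕ}

theorem measurable_complexMk : Measurable (fun z : ℝ × ℝ => (⟨z.1, z.2⟩ : ℂ)) :=
  Complex.measurableEquivRealProd.symm.measurable

instance isProbabilityMeasure_complexGaussianLaw (v : ℝ≥0) :
    IsProbabilityMeasure (complexGaussianLaw v) :=
  Measure.isProbabilityMeasure_map measurable_complexMk.aemeasurable

theorem charFun_complexGaussianLaw (v : ℝ≥0) (z : ℂ) :
    charFun (complexGaussianLaw v) z = Complex.exp (-(v * ‖z‖ ^ 2 / 2)) := by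
  rw [charFun_apply, complexGaussianLaw, integral_map measurable_complexMk.aemeasurable
    (by fun_prop)]
  have : ∀ w : ℝ × ℝ, Complex.exp ((inner ℝ (⟨w.1, w.2⟩ : ℂ) z : ℝ) * Complex.I) =
      Complex.exp ((z.re : ℂ) * w.1 * Complex.I) * Complex.exp ((z.im : ℂ) * w.2 * Complex.I) := by
    intro w
    rw [← Complex.exp_add, Complex.inner]
    congr 1
    simp only [Complex.mul_re, Complex.conj_re, Complex.conj_im]
    push_cast
    ring
  simp_rw [this]
  rw [integral_prod_mul (fun x : ℝ => Complex.exp ((z.re : ℂ) * x * Complex.I))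
    (fun x : ℝ => Complex.exp ((z.im : ℂ) * x * Complex.I)), ← charFun_apply_real,
    ← charFun_apply_real, charFun_gaussianReal, charFun_gaussianReal, ← Complex.exp_add]
  congr 1
  have : ((‖z‖ : ℝ) : ℂ) ^ 2 = z.re ^ 2 + z.im ^ 2 := by
    rw [← Complex.ofReal_pow, Complex.sq_norm, Complex.normSq_apply]
    push_cast
    ring
  rw [this]
  push_cast
  ring

theorem integrable_norm_pow_four_complexGaussianLaw (v : ℝ≥0) :
    Integrable (fun z => ‖z‖ ^ 4) (complexGaussianLaw v) := by
  rw [complexGaussianLaw, integrable_map_measure (by fun_prop) measurable_complexMk.aemeasurable]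
  have h4 : Integrable (fun x : ℝ => x ^ 4) (gaussianReal 0 v) := by
    have := (memLp_id_gaussianReal (μ := 0) (v := v) 4).integrable_norm_pow (by norm_num)
    refine this.congr (ae_of_all _ fun x => ?_)
    simp [Even.pow_abs (show Even 4 by decide)]
  refine Integrable.mono' (((h4.comp_fst (gaussianReal 0 v)).add
    (h4.comp_snd (gaussianReal 0 v))).const_mul 2)
    (Measurable.aestronglyMeasurable ((measurable_norm.comp measurable_complexMk).pow_const 4))
    (ae_of_all _ fun w => ?_)
  simp only [Function.comp_apply, Pi.add_apply]
  rw [Real.norm_of_nonneg (by positivity), show ∀ r : ℝ, r ^ 4 = (r ^ 2) ^ 2 by intro r; ring,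
    Complex.sq_norm, Complex.normSq_apply]
  nlinarith [sq_nonneg (w.1 * w.1 - w.2 * w.2)]

theorem integral_norm_sq_complexGaussianLaw (v : ℝ≥0) :
    ∫ z, ‖z‖ ^ 2 ∂(complexGaussianLaw v) = 2 * v := by
  rw [complexGaussianLaw, integral_map measurable_complexMk.aemeasurable (by fun_prop)]
  have h2 : Integrable (fun x : ℝ => x ^ 2) (gaussianReal 0 v) := by
    have := (memLp_id_gaussianReal (μ := 0) (v := v) 2).integrable_norm_pow (by norm_num)
    refine this.congr (ae_of_all _ fun x => ?_)
    simp
  have h3 : ∫ x, x ^ 2 ∂(gaussianReal 0 v) = v := by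
    have := variance_fun_id_gaussianReal (μ := 0) (v := v)
    rw [variance_eq_integral (by fun_prop)] at this
    simpa using this
  have : ∀ w : ℝ × ℝ, ‖(⟨w.1, w.2⟩ : ℂ)‖ ^ 2 = w.1 ^ 2 + w.2 ^ 2 := fun w => by
    rw [Complex.sq_norm, Complex.normSq_apply]; ring
  simp_rw [this]
  rw [integral_add (h2.comp_fst _) (h2.comp_snd _), integral_fun_fst (fun x : ℝ => x ^ 2),
    integral_fun_snd (fun x : ℝ => x ^ 2), h3]
  simp
  ring

theorem isProbabilityMeasure_gaussianVectorLaw : IsProbabilityMeasure (gaussianVectorLaw d) :=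
  Measure.isProbabilityMeasure_map (by fun_prop)

theorem charFun_gaussianVectorLaw (t : EuclideanSpace ℂ (Fin d)) :
    charFun (gaussianVectorLaw d) t =
      Complex.exp (-(((1 / (2 * (d : ℝ≥0)) : ℝ≥0) : ℂ) * ‖t‖ ^ 2 / 2)) := by
  rw [gaussianVectorLaw, charFun_pi]
  simp_rw [charFun_complexGaussianLaw]
  rw [← Complex.exp_sum, ← Complex.ofReal_pow, EuclideanSpace.norm_sq_eq]
  congr 1
  rw [Finset.sum_neg_distrib, ← Finset.sum_div, ← Finset.mul_sum]
  push_cast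
  rfl

/-- The characteristic function depends on its argument only through the norm. -/
theorem map_gaussianVectorLaw (L : EuclideanSpace ℂ (Fin d) ≃ₗᵢ[ℂ] EuclideanSpace ℂ (Fin d)) :
    (gaussianVectorLaw d).map L = gaussianVectorLaw d := by
  have := isProbabilityMeasure_gaussianVectorLaw (d := d)
  have hL : Measurable L := L.continuous.measurable
  have : IsProbabilityMeasure ((gaussianVectorLaw d).map L) :=
    Measure.isProbabilityMeasure_map hL.aemeasurable
  apply Measure.ext_of_charFun
  funext t
  let L' : EuclideanSpace ℂ (Fin d) ≃ₗᵢ[ℝ] EuclideanSpace ℂ (Fin d) :=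
    { toLinearEquiv := L.toLinearEquiv.restrictScalars ℝ
      norm_map' := L.norm_map }
  have h1 : charFun ((gaussianVectorLaw d).map L) t = charFun (gaussianVectorLaw d) (L'.symm t) := by
    rw [charFun_apply, charFun_apply, integral_map hL.aemeasurable (by fun_prop)]
    congr 1
    funext u
    rw [← L'.inner_map_map u, L'.apply_symm_apply]
    rfl
  rw [h1, charFun_gaussianVectorLaw, charFun_gaussianVectorLaw, L'.symm.norm_map]

theorem integral_coord_gaussianVectorLaw (f : ℂ → ℝ) (hf : Continuous f) (i : Fin d) :
    ∫ u, f (u i) ∂(gaussianVectorLaw d) = ∫ z, f z ∂(complexGaussianLaw (1 / (2 * (d : ℝ≥0)))) := by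
  rw [gaussianVectorLaw, integral_map (by fun_prop)
    (Continuous.aestronglyMeasurable (by fun_prop))]
  have := measurePreserving_eval (fun _ : Fin d => complexGaussianLaw (1 / (2 * (d : ℝ≥0)))) i
  conv_rhs => rw [← this.map_eq, integral_map this.measurable.aemeasurable hf.aestronglyMeasurable]

/-- The fourth moment is not computed directly: by unitary invariance it is `2 E|u_i|²|u_j|²`, which
factorizes by independence into `2 / d ^ 2`. The assumption `2 ≤ d` supplies the second coordinate
`j`. -/
theorem factorLaw_gaussianVectorLaw (hd : 2 ≤ d) : FactorLaw (gaussianVectorLaw d) := by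
  have hp := isProbabilityMeasure_gaussianVectorLaw (d := d)
  have hd' : (0 : ℝ) < d := by positivity
  have h2 : ∀ i, ∫ u, ‖u i‖ ^ 2 ∂(gaussianVectorLaw d) = 1 / d := fun i => by
    rw [integral_coord_gaussianVectorLaw (fun z => ‖z‖ ^ 2) (by fun_prop),
      integral_norm_sq_complexGaussianLaw]
    push_cast
    field_simp
  have hi4 : ∀ i, Integrable (fun u : EuclideanSpace ℂ (Fin d) => ‖u i‖ ^ 4)
      (gaussianVectorLaw d) := fun i => by
    rw [gaussianVectorLaw, integrable_map_measure (Continuous.aestronglyMeasurable (by fun_prop))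
      (by fun_prop)]
    exact (measurePreserving_eval (fun _ : Fin d => complexGaussianLaw (1 / (2 * (d : ℝ≥0))))
      i).integrable_comp_of_integrable (integrable_norm_pow_four_complexGaussianLaw _)
  have hU : UnitarilyInvariant (gaussianVectorLaw d) :=
    { isProbabilityMeasure := hp
      map_eq := map_gaussianVectorLaw
      integrable := by
        refine Integrable.mono' ((integrable_finsetSum Finset.univ fun i _ => hi4 i).const_mul (d : ℝ))
          (Continuous.aestronglyMeasurable (by fun_prop)) (ae_of_all _ fun u => ?_)
        rw [Real.norm_of_nonneg (by positivity), show ∀ r : ℝ, r ^ 4 = (r ^ 2) ^ 2 by intro r; ring,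
          EuclideanSpace.norm_sq_eq]
        have := sq_sum_le_card_mul_sum_sq (s := Finset.univ) (f := fun i => ‖u i‖ ^ 2)
        simpa [← pow_mul] using this }
  refine ⟨hU, ?_, fun i => ?_⟩
  · simp_rw [EuclideanSpace.norm_sq_eq]
    rw [integral_finsetSum _ fun i _ => hU.integrable_coord_sq i]
    simp_rw [h2]
    simp [hd'.ne']
  · have : Nontrivial (Fin d) := Fin.nontrivial_iff_two_le.2 hd
    obtain ⟨j, hj⟩ := exists_ne i
    rw [hU.integral_pow_four_eq hj.symm]
    have hind : IndepFun (fun w : Fin d → ℂ => ‖w i‖ ^ 2) (fun w => ‖w j‖ ^ 2)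
        (Measure.pi fun _ : Fin d => complexGaussianLaw (1 / (2 * (d : ℝ≥0)))) :=
      (iIndepFun_pi (X := fun _ (z : ℂ) => ‖z‖ ^ 2) fun _ =>
        Measurable.aemeasurable (by fun_prop)).indepFun hj.symm
    have e := hind.integral_fun_mul_eq_mul_integral
      (Continuous.aestronglyMeasurable (by fun_prop)) (Continuous.aestronglyMeasurable (by fun_prop))
    have e' : ∀ f : (Fin d → ℂ) → ℝ, Continuous f → ∫ w, f w
        ∂(Measure.pi fun _ : Fin d => complexGaussianLaw (1 / (2 * (d : ℝ≥0)))) =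
        ∫ u, f u.ofLp ∂(gaussianVectorLaw d) := fun f hf => by
      rw [gaussianVectorLaw, integral_map (by fun_prop)
        (Continuous.aestronglyMeasurable (by fun_prop))]
    rw [e' _ (by fun_prop), e' _ (by fun_prop), e' _ (by fun_prop), h2, h2] at e
    rw [e]
    field_simp
    exact le_refl _

end Gaussian

theorem factorLaw_ensemble (e : Ensemble) {d : ℕ} (hd : 2 ≤ d) : FactorLaw (e.factorLaw d) := by
  cases e
  · exact factorLaw_unitVectorLaw (by omega)
  · exact factorLaw_gaussianVectorLaw hd

end RandomProductStates
end

noncomputable section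
namespace RandomProductStates
open Matrix

/-! ### Tensor products, contractions and partial traces. -/

section ProductVector
variable {d k : ℕ}

theorem continuous_quadForm {ι : Type*} [Fintype ι] (A : Matrix ι ι ℂ) :
    Continuous (quadForm A) := by
  unfold quadForm
  refine Complex.continuous_re.comp ?_
  exact Continuous.dotProduct continuous_star (Continuous.matrix_mulVec continuous_const continuous_id)

theorem continuous_productVector :
    Continuous (productVector : (Fin k → EuclideanSpace ℂ (Fin d)) → _) := by
  unfold productVector
  fun_prop

/-- The tensor product of a vector of `ℂ^d` with a vector of `(ℂ^d)^{⊗ k}`. -/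
def tensorCons (u : Fin d → ℂ) (w : (Fin k → Fin d) → ℂ) : (Fin (k + 1) → Fin d) → ℂ :=
  fun f => u (f 0) * w (Fin.tail f)

theorem productVector_cons (u : EuclideanSpace ℂ (Fin d)) (us : Fin k → EuclideanSpace ℂ (Fin d)) :
    productVector (Fin.cons u us : Fin (k + 1) → EuclideanSpace ℂ (Fin d)) =
      tensorCons u.ofLp (productVector us) := by
  funext f
  simp [productVector, tensorCons, Fin.prod_univ_succ, Fin.tail]

theorem sum_fin_succ_fun {M : Type*} [AddCommMonoid M] (F : (Fin (k + 1) → Fin d) → M) :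
    ∑ f, F f = ∑ i, ∑ j, F (Fin.cons i j) := by
  rw [← (Fin.consEquiv fun _ => Fin d).sum_comp, Fintype.sum_prod_type]
  rfl

theorem normSq_tensorCons (u : Fin d → ℂ) (w : (Fin k → Fin d) → ℂ) :
    normSq (tensorCons u w) = normSq u * normSq w := by
  rw [normSq, sum_fin_succ_fun, normSq, normSq, Finset.sum_mul_sum]
  simp [tensorCons, mul_pow]

theorem tensorCons_single (i : Fin d) (j : Fin k → Fin d) :
    tensorCons (Pi.single i 1) (Pi.single j 1) =
      Pi.single (Fin.cons i j : Fin (k + 1) → Fin d) 1 := by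
  funext f
  rw [tensorCons]
  conv_rhs => rw [← Fin.cons_self_tail f]
  simp only [Pi.single_apply, Fin.cons_inj]
  split_ifs <;> simp_all

/-- The operator `w ↦ u ⊗ w`. -/
def tensorLeft (k : ℕ) (u : Fin d → ℂ) : Matrix (Fin (k + 1) → Fin d) (Fin k → Fin d) ℂ :=
  of fun f j => u (f 0) * (1 : Matrix _ _ ℂ) (Fin.tail f) j

/-- The operator `u ↦ u ⊗ w`. -/
def tensorRight (w : (Fin k → Fin d) → ℂ) : Matrix (Fin (k + 1) → Fin d) (Fin d) ℂ :=
  of fun f i => (1 : Matrix _ _ ℂ) (f 0) i * w (Fin.tail f)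

theorem tensorLeft_mulVec (u : Fin d → ℂ) (w : (Fin k → Fin d) → ℂ) :
    tensorLeft k u *ᵥ w = tensorCons u w := by
  funext f
  simp [tensorLeft, tensorCons, mulVec, dotProduct, Matrix.one_apply]

theorem tensorRight_mulVec (u : Fin d → ℂ) (w : (Fin k → Fin d) → ℂ) :
    tensorRight w *ᵥ u = tensorCons u w := by
  funext f
  simp [tensorRight, tensorCons, mulVec, dotProduct, Matrix.one_apply, mul_comm]

theorem quadForm_conjTranspose_mul_mul {ι κ : Type*} [Fintype ι] [Fintype κ] (A : Matrix ι ι ℂ)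
    (T : Matrix ι κ ℂ) (v : κ → ℂ) : quadForm (Tᴴ * A * T) v = quadForm A (T *ᵥ v) := by
  rw [quadForm, quadForm, ← mulVec_mulVec, ← mulVec_mulVec, star_mulVec, ← dotProduct_mulVec]

theorem quadForm_sum {ι κ : Type*} [Fintype ι] (s : Finset κ) (A : κ → Matrix ι ι ℂ) (v : ι → ℂ) :
    quadForm (∑ j ∈ s, A j) v = ∑ j ∈ s, quadForm (A j) v := by
  simp only [quadForm, sum_mulVec, dotProduct_sum, Complex.re_sum]

/-- Contraction of `A` against the first factor. -/
def contract (A : Matrix (Fin (k + 1) → Fin d) (Fin (k + 1) → Fin d) ℂ) (u : Fin d → ℂ) :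
    Matrix (Fin k → Fin d) (Fin k → Fin d) ℂ :=
  (tensorLeft k u)ᴴ * A * tensorLeft k u

/-- The partial trace of `A` over all factors but the first. -/
def partialTrace (A : Matrix (Fin (k + 1) → Fin d) (Fin (k + 1) → Fin d) ℂ) :
    Matrix (Fin d) (Fin d) ℂ :=
  ∑ j : Fin k → Fin d, (tensorRight (Pi.single j 1))ᴴ * A * tensorRight (Pi.single j 1)

variable {A : Matrix (Fin (k + 1) → Fin d) (Fin (k + 1) → Fin d) ℂ} {C : ℝ}

theorem quadForm_contract (u : Fin d → ℂ) (w : (Fin k → Fin d) → ℂ) :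
    quadForm (contract A u) w = quadForm A (tensorCons u w) := by
  rw [contract, quadForm_conjTranspose_mul_mul, tensorLeft_mulVec]

theorem quadForm_partialTrace (u : Fin d → ℂ) :
    quadForm (partialTrace A) u = ∑ j, quadForm A (tensorCons u (Pi.single j 1)) := by
  rw [partialTrace, quadForm_sum]
  simp_rw [quadForm_conjTranspose_mul_mul, tensorRight_mulVec]

/-- This links the two stages of the induction on the number of factors: the conditional centering,
given the first factor `u`, is itself a quadratic form in `u`. -/
theorem trace_contract (u : Fin d → ℂ) :
    (contract A u).trace.re = quadForm (partialTrace A) u := by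
  rw [trace_re_eq_sum_quadForm, quadForm_partialTrace]
  simp_rw [quadForm_contract]

theorem trace_partialTrace : (partialTrace A).trace.re = A.trace.re := by
  rw [trace_re_eq_sum_quadForm, trace_re_eq_sum_quadForm, sum_fin_succ_fun]
  simp_rw [quadForm_partialTrace, tensorCons_single]

theorem FormBounded.contract (hA : FormBounded A C) (u : Fin d → ℂ) :
    FormBounded (contract A u) (C * normSq u) where
  isHermitian := isHermitian_conjTranspose_mul_mul _ hA.1
  abs_quadForm_le v := by
    rw [quadForm_contract, mul_assoc, ← normSq_tensorCons]
    exact hA.2 _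

theorem FormBounded.partialTrace (hA : FormBounded A C) :
    FormBounded (partialTrace A) (C * (d : ℝ) ^ k) where
  isHermitian := by
    rw [RandomProductStates.partialTrace, IsHermitian, conjTranspose_sum]
    exact Finset.sum_congr rfl fun j _ => isHermitian_conjTranspose_mul_mul _ hA.1
  abs_quadForm_le v := by
    rw [quadForm_partialTrace]
    refine (Finset.abs_sum_le_sum_abs _ _).trans ?_
    refine (Finset.sum_le_sum fun j _ => hA.2 _).trans ?_
    simp_rw [normSq_tensorCons, normSq_single]
    simp only [mul_one, Finset.sum_const, Finset.card_univ, Fintype.card_fun, Fintype.card_fin,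
      nsmul_eq_mul]
    push_cast
    exact le_of_eq (by ring)

end ProductVector

/-! ### Concentration of quadratic forms in product vectors. -/

/-- A law on `ℂ^ι` for which quadratic forms concentrate around their normalized trace. -/
structure QuadraticConcentration {ι : Type*} [Fintype ι] (Q : Measure (ι → ℂ)) (κ : ℝ) : Prop where
  isProbabilityMeasure : IsProbabilityMeasure Q
  lintegral_le : ∀ (A : Matrix ι ι ℂ) (C : ℝ), FormBounded A C →
    ∫⁻ v, ENNReal.ofReal ((quadForm A v - A.trace.re / Fintype.card ι) ^ 2) ∂Q ≤
      ENNReal.ofReal (κ * C ^ 2)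

/-- The law of a random product vector with factors of law `P`. -/
def productLaw {d : ℕ} (P : Measure (EuclideanSpace ℂ (Fin d))) (k : ℕ) :
    Measure ((Fin k → Fin d) → ℂ) :=
  (Measure.pi fun _ : Fin k => P).map productVector

/-- The constant in the variance bound for quadratic forms in a product of `k` vectors. -/
def varianceConstant : ℕ → ℝ
  | 0 => 0
  | k + 1 => 4 * varianceConstant k + 2

theorem varianceConstant_nonneg (k : ℕ) : 0 ≤ varianceConstant k := by
  induction k with
  | zero => exact le_refl _
  | succ k ih => rw [varianceConstant]; positivity

/-- Induction on `k`, splitting off the first factor `u`. The deviation is the deviation of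
`contract A u` in the remaining factors plus `d ^ (-k)` times that of `partialTrace A` in `u`. The
first form is bounded by `C ‖u‖²`, so its variance averages to at most `2 C² varianceConstant k /
d`, because `E‖u‖⁴ ≤ 2`; the second is bounded by `C d ^ k` and contributes `C² / d`. The inequality
`(a + b)² ≤ 2 a² + 2 b²` then produces the recursion of `varianceConstant`. -/
theorem quadraticConcentration_productLaw {d : ℕ} (hd : 1 ≤ d)
    {P : Measure (EuclideanSpace ℂ (Fin d))} (h : FactorLaw P) (k : ℕ) :
    QuadraticConcentration (productLaw P k) (varianceConstant k / d) := by
  have := h.isProbabilityMeasure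
  have hd' : (0 : ℝ) < d := by exact_mod_cast hd
  refine ⟨Measure.isProbabilityMeasure_map continuous_productVector.measurable.aemeasurable, ?_⟩
  induction k with
  -- With no factors the space is one-dimensional and the vector is `1`, so the form equals the
  -- trace and the constant is `0`.
  | zero =>
    intro A C hA
    rw [productLaw, lintegral_map (by have := continuous_quadForm A; fun_prop)
      continuous_productVector.measurable]
    have : ∀ us : Fin 0 → EuclideanSpace ℂ (Fin d), productVector us = fun _ => 1 := fun us => by
      funext f; simp [productVector]
    simp_rw [this]
    have e : quadForm A (fun _ => 1) = A.trace.re := by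
      simp [quadForm, trace, dotProduct, mulVec]
    simp [e, varianceConstant]
  | succ k ih =>
    intro A C hA
    have hN : (0 : ℝ) < (d : ℝ) ^ k := by positivity
    have hmeas : Measurable fun v : (Fin (k + 1) → Fin d) → ℂ =>
        ENNReal.ofReal ((quadForm A v - A.trace.re / Fintype.card (Fin (k + 1) → Fin d)) ^ 2) := by
      have := continuous_quadForm A
      fun_prop
    have hmeas' : Measurable fun us : Fin (k + 1) → EuclideanSpace ℂ (Fin d) => ENNReal.ofReal
        ((quadForm A (productVector us) - A.trace.re / Fintype.card (Fin (k + 1) → Fin d)) ^ 2) :=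
      hmeas.comp continuous_productVector.measurable
    have hmp := (measurePreserving_piFinSuccAbove
      (fun _ : Fin (k + 1) => (P : Measure (EuclideanSpace ℂ (Fin d)))) 0).symm
    have hmeas'' : Measurable fun z : EuclideanSpace ℂ (Fin d) × (Fin k → EuclideanSpace ℂ (Fin d)) =>
        ENNReal.ofReal ((quadForm A (productVector
          ((MeasurableEquiv.piFinSuccAbove (fun _ => EuclideanSpace ℂ (Fin d)) 0).symm z)) -
          A.trace.re / Fintype.card (Fin (k + 1) → Fin d)) ^ 2) :=
      hmeas'.comp (MeasurableEquiv.measurable _)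
    rw [productLaw, lintegral_map hmeas continuous_productVector.measurable,
      ← hmp.lintegral_comp hmeas',
      lintegral_prod _ hmeas''.aemeasurable]
    have key : ∀ (u : EuclideanSpace ℂ (Fin d)) (us : Fin k → EuclideanSpace ℂ (Fin d)),
        ENNReal.ofReal ((quadForm A (productVector
          ((MeasurableEquiv.piFinSuccAbove (fun _ => EuclideanSpace ℂ (Fin d)) 0).symm (u, us))) -
          A.trace.re / Fintype.card (Fin (k + 1) → Fin d)) ^ 2) ≤
        ENNReal.ofReal 2 * ENNReal.ofReal ((quadForm (contract A u.ofLp) (productVector us) -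
          (contract A u.ofLp).trace.re / Fintype.card (Fin k → Fin d)) ^ 2) +
        ENNReal.ofReal 2 * ENNReal.ofReal (((d : ℝ) ^ k)⁻¹ ^ 2 *
          (quadForm (partialTrace A) u.ofLp - (partialTrace A).trace.re / d) ^ 2) := by
      intro u us
      have e1 : (MeasurableEquiv.piFinSuccAbove (fun _ : Fin (k + 1) => EuclideanSpace ℂ (Fin d))
          0).symm (u, us) = Fin.cons u us := by
        simp [MeasurableEquiv.piFinSuccAbove]
        rfl
      rw [e1, productVector_cons, quadForm_contract, trace_contract, trace_partialTrace,
        ← ENNReal.ofReal_mul (by norm_num),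
        ← ENNReal.ofReal_mul (by norm_num), ← ENNReal.ofReal_add (by positivity) (by positivity)]
      apply ENNReal.ofReal_le_ofReal
      simp only [Fintype.card_fun, Fintype.card_fin]
      push_cast
      set q := quadForm A (tensorCons u.ofLp (productVector us))
      set r := quadForm (partialTrace A) u.ofLp
      have e2 : q - A.trace.re / (d : ℝ) ^ (k + 1) = (q - r / (d : ℝ) ^ k) +
          ((d : ℝ) ^ k)⁻¹ * (r - A.trace.re / d) := by
        field_simp
        ring
      rw [e2]
      -- This is `(a + b)² ≤ 2 a² + 2 b²`, whose defect is `(a - b)²`.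
      nlinarith [sq_nonneg ((q - r / (d : ℝ) ^ k) - ((d : ℝ) ^ k)⁻¹ * (r - A.trace.re / d))]
    have hκ := varianceConstant_nonneg k
    calc _ ≤ ∫⁻ u, ∫⁻ us, (ENNReal.ofReal 2 * ENNReal.ofReal ((quadForm (contract A u.ofLp) (productVector us) -
          (contract A u.ofLp).trace.re / Fintype.card (Fin k → Fin d)) ^ 2) +
        ENNReal.ofReal 2 * ENNReal.ofReal (((d : ℝ) ^ k)⁻¹ ^ 2 *
          (quadForm (partialTrace A) u.ofLp - (partialTrace A).trace.re / d) ^ 2))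
          ∂(Measure.pi fun _ : Fin k => P) ∂P :=
        lintegral_mono fun u => lintegral_mono fun us => key u us
      _ ≤ ∫⁻ u, (ENNReal.ofReal 2 * ENNReal.ofReal (varianceConstant k / d * C ^ 2 * ‖u‖ ^ 4) +
          ENNReal.ofReal 2 * ENNReal.ofReal (((d : ℝ) ^ k)⁻¹ ^ 2 *
          (quadForm (partialTrace A) u.ofLp - (partialTrace A).trace.re / d) ^ 2)) ∂P := by
        refine lintegral_mono fun u => ?_
        rw [lintegral_add_right _ measurable_const, lintegral_const, measure_univ, mul_one,
          lintegral_const_mul' _ _ ENNReal.ofReal_ne_top]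
        gcongr
        have := ih (contract A u.ofLp) _ (hA.contract u.ofLp)
        rw [productLaw, lintegral_map (by
          have := continuous_quadForm (contract A u.ofLp); fun_prop)
          continuous_productVector.measurable] at this
        refine this.trans_eq ?_
        rw [← norm_sq_eq_normSq]
        congr 1
        ring
      _ ≤ ENNReal.ofReal 2 * ENNReal.ofReal (varianceConstant k / d * C ^ 2 * 2) +
          ENNReal.ofReal 2 * ENNReal.ofReal (((d : ℝ) ^ k)⁻¹ ^ 2 * ((C * (d : ℝ) ^ k) ^ 2 / d)) := by
        rw [lintegral_add_left (by fun_prop), lintegral_const_mul' _ _ ENNReal.ofReal_ne_top,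
          lintegral_const_mul' _ _ ENNReal.ofReal_ne_top]
        obtain ⟨hi, hle⟩ := h.variance_quadForm_le hd hA.partialTrace
        rw [← ofReal_integral_eq_lintegral_ofReal (h.integrable.const_mul _)
            (ae_of_all _ fun u => by positivity),
          ← ofReal_integral_eq_lintegral_ofReal (hi.const_mul _)
            (ae_of_all _ fun u => by positivity), integral_const_mul, integral_const_mul]
        gcongr
        exact h.integral_norm_pow_four_le hd
      _ = ENNReal.ofReal (varianceConstant (k + 1) / d * C ^ 2) := by
        rw [← ENNReal.ofReal_mul (by norm_num),
          ← ENNReal.ofReal_mul (by norm_num), ← ENNReal.ofReal_add (by positivity) (by positivity)]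
        congr 1
        rw [varianceConstant]
        field_simp
        ring

end RandomProductStates
end

noncomputable section
namespace RandomProductStates

/-! ### McDiarmid's inequality. -/

section BoundedDifferences
variable {E : Type*} [MeasurableSpace E] {Q : Measure E} [IsProbabilityMeasure Q]

theorem integrable_of_abs_le {α : Type*} [MeasurableSpace α] {ν : Measure α} [IsFiniteMeasure ν]
    {f : α → ℝ} (hf : Measurable f) {B : ℝ} (hB : ∀ a, |f a| ≤ B) : Integrable f ν :=
  Integrable.of_bound hf.aestronglyMeasurable B (ae_of_all _ hB)

/-- Hoeffding's lemma, with the range of the variable measured by its oscillation. -/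
theorem integral_exp_le_of_oscillation {g : E → ℝ} (hg : Measurable g) {B c : ℝ}
    (hB : ∀ a, |g a| ≤ B) (hc : ∀ a b, |g a - g b| ≤ c) (l : ℝ) :
    ∫ a, Real.exp (l * (g a - ∫ b, g b ∂Q)) ∂Q ≤ Real.exp (c ^ 2 * l ^ 2 / 2) := by
  have hgi : Integrable g Q := integrable_of_abs_le hg hB
  set m := ∫ b, g b ∂Q with hm
  -- Only the distance to the mean is used, so the interval has length `2 c`. This gives the
  -- variance proxy `c ^ 2` in place of the sharp `c ^ 2 / 4`, which is enough here.
  have hmem : ∀ a, g a ∈ Set.Icc (m - c) (m + c) := fun a => by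
    have h1 : ∫ b, (g a - g b) ∂Q = g a - m := by
      rw [integral_sub (integrable_const _) hgi]; simp [hm]
    have h2 : |∫ b, (g a - g b) ∂Q| ≤ c := by
      have := norm_integral_le_of_norm_le_const (μ := Q) (f := fun b => g a - g b)
        (ae_of_all _ (hc a))
      simpa using this
    rw [h1, abs_le] at h2
    constructor <;> linarith
  have hc0 : 0 ≤ c := by
    obtain ⟨a⟩ := nonempty_of_isProbabilityMeasure Q
    exact (abs_nonneg _).trans (hc a a)
  have := (hasSubgaussianMGF_of_mem_Icc hg.aemeasurable (ae_of_all Q hmem)).mgf_le l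
  refine this.trans_eq ?_
  congr 1
  have : ((‖m + c - (m - c)‖₊ / 2 : ℝ≥0) : ℝ) = c := by
    push_cast
    rw [show m + c - (m - c) = 2 * c by ring, Real.norm_of_nonneg (by positivity)]
    ring
  push_cast at this ⊢
  rw [this]

/-- The exponential form of McDiarmid's bounded differences inequality. -/
theorem integral_exp_le_of_bounded_differences (p : ℕ) {f : (Fin p → E) → ℝ} (hf : Measurable f)
    {B c : ℝ} (hB : ∀ a, |f a| ≤ B)
    (hc : ∀ (X : Fin p → E) (s : Fin p) (y : E), |f X - f (Function.update X s y)| ≤ c) (l : ℝ) :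
    ∫ X, Real.exp (l * (f X - ∫ Y, f Y ∂(Measure.pi fun _ => Q))) ∂(Measure.pi fun _ => Q) ≤
      Real.exp (p * c ^ 2 * l ^ 2 / 2) := by
  induction p generalizing B with
  | zero => simp [integral_unique, Measure.real]
  | succ p ih =>
    set e := MeasurableEquiv.piFinSuccAbove (fun _ : Fin (p + 1) => E) 0 with he
    have hmp := (measurePreserving_piFinSuccAbove (fun _ : Fin (p + 1) => Q) 0).symm
    have hcons : ∀ x X, e.symm (x, X) = Fin.cons x X := fun x X => by
      simp [he, MeasurableEquiv.piFinSuccAbove]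
      rfl
    have hint : ∀ F : (Fin (p + 1) → E) → ℝ, Measurable F → (∃ D, ∀ a, |F a| ≤ D) →
        ∫ X, F X ∂(Measure.pi fun _ => Q) =
          ∫ x, ∫ X, F (Fin.cons x X) ∂(Measure.pi fun _ => Q) ∂Q := by
      rintro F hF ⟨D, hD⟩
      have hi : Integrable (fun z => F (e.symm z)) (Q.prod (Measure.pi fun _ : Fin p => Q)) :=
        integrable_of_abs_le (hF.comp e.symm.measurable) fun a => hD _
      rw [← hmp.integral_comp e.symm.measurableEmbedding, integral_prod _ hi]
      simp_rw [← hcons]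
    have hfc : Measurable fun z : E × (Fin p → E) => f (Fin.cons z.1 z.2) := by
      simp_rw [← hcons]
      exact hf.comp e.symm.measurable
    have hfx : ∀ x, Measurable fun X : Fin p → E => f (Fin.cons x X) := fun x =>
      hfc.comp measurable_prodMk_left
    -- The conditional mean given the first variable. It inherits the oscillation bound `c`, while
    -- the fluctuation of `f` around it is governed by the induction hypothesis.
    set g : E → ℝ := fun x => ∫ X, f (Fin.cons x X) ∂(Measure.pi fun _ : Fin p => Q) with hg
    have hgm : Measurable g := (hfc.stronglyMeasurable.integral_prod_right').measurable
    have hfi : ∀ x, Integrable (fun X : Fin p → E => f (Fin.cons x X)) (Measure.pi fun _ => Q) :=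
      fun x => integrable_of_abs_le (hfx x) fun X => hB _
    have hgB : ∀ x, |g x| ≤ B := fun x => by
      have := norm_integral_le_of_norm_le_const (μ := Measure.pi fun _ : Fin p => Q)
        (f := fun X => f (Fin.cons x X)) (ae_of_all _ fun X => hB (Fin.cons x X))
      simpa using this
    have hgc : ∀ x y, |g x - g y| ≤ c := fun x y => by
      rw [hg]
      simp only
      rw [← integral_sub (hfi x) (hfi y)]
      have := norm_integral_le_of_norm_le_const (μ := Measure.pi fun _ : Fin p => Q) (C := c)
        (f := fun X => f (Fin.cons x X) - f (Fin.cons y X)) (ae_of_all _ fun X => by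
          have := hc (Fin.cons x X) 0 y
          rwa [Fin.update_cons_zero] at this)
      simpa using this
    have hm : ∫ Y, f Y ∂(Measure.pi fun _ => Q) = ∫ x, g x ∂Q := hint f hf ⟨B, hB⟩
    rw [hm, hint _ (by fun_prop) ⟨Real.exp (|l| * (B + |∫ x, g x ∂Q|)), fun a => by
      rw [Real.abs_exp]
      refine Real.exp_le_exp.2 ((le_abs_self _).trans ?_)
      rw [abs_mul]
      gcongr
      exact (abs_sub _ _).trans (by gcongr; exact hB a)⟩]
    set m := ∫ x, g x ∂Q with hmdef
    have hstep : ∀ x, ∫ X, Real.exp (l * (f (Fin.cons x X) - m)) ∂(Measure.pi fun _ : Fin p => Q) ≤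
        Real.exp (p * c ^ 2 * l ^ 2 / 2) * Real.exp (l * (g x - m)) := fun x => by
      have h1 := ih (hfx x) (fun X => hB _) (fun X s y => by
        have := hc (Fin.cons x X) s.succ y
        rwa [← Fin.cons_update] at this)
      have h2 : ∀ X : Fin p → E, Real.exp (l * (f (Fin.cons x X) - m)) =
          Real.exp (l * (f (Fin.cons x X) - g x)) * Real.exp (l * (g x - m)) := fun X => by
        rw [← Real.exp_add]; congr 1; ring
      simp_rw [h2]
      rw [integral_mul_const]
      gcongr
    have hgexp : Integrable (fun x => Real.exp (l * (g x - m))) Q :=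
      integrable_of_abs_le (B := Real.exp (|l| * (B + |m|))) (by fun_prop) fun a => by
        rw [Real.abs_exp]
        refine Real.exp_le_exp.2 ((le_abs_self _).trans ?_)
        rw [abs_mul]
        gcongr
        exact (abs_sub _ _).trans (by gcongr; exact hgB a)
    calc _ ≤ ∫ x, Real.exp (p * c ^ 2 * l ^ 2 / 2) * Real.exp (l * (g x - m)) ∂Q := by
          refine integral_mono_of_nonneg (ae_of_all _ fun x => ?_) (hgexp.const_mul _)
            (ae_of_all _ hstep)
          exact integral_nonneg fun X => (Real.exp_pos _).le
      _ ≤ Real.exp (p * c ^ 2 * l ^ 2 / 2) * Real.exp (c ^ 2 * l ^ 2 / 2) := by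
          rw [integral_const_mul]
          gcongr
          exact integral_exp_le_of_oscillation hgm hgB hgc l
      _ = _ := by
          rw [← Real.exp_add]
          congr 1
          push_cast
          ring

/-- McDiarmid's bounded differences inequality. -/
theorem measure_abs_sub_ge_le {p : ℕ} {f : (Fin p → E) → ℝ} (hf : Measurable f)
    {B c : ℝ} (hB : ∀ a, |f a| ≤ B)
    (hc : ∀ (X : Fin p → E) (s : Fin p) (y : E), |f X - f (Function.update X s y)| ≤ c)
    (hpc : 0 < p * c ^ 2) {ε : ℝ} (hε : 0 ≤ ε) :
    (Measure.pi fun _ : Fin p => Q).real {X | ε ≤ |f X - ∫ Y, f Y ∂(Measure.pi fun _ => Q)|} ≤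
      2 * Real.exp (-ε ^ 2 / (2 * (p * c ^ 2))) := by
  set m := ∫ Y, f Y ∂(Measure.pi fun _ : Fin p => Q) with hm
  have hsub : HasSubgaussianMGF (fun X => f X - m) ⟨p * c ^ 2, hpc.le⟩
      (Measure.pi fun _ : Fin p => Q) :=
    { integrable_exp_mul := fun l =>
        integrable_of_abs_le (B := Real.exp (|l| * (B + |m|))) (by fun_prop) fun a => by
          rw [Real.abs_exp]
          refine Real.exp_le_exp.2 ((le_abs_self _).trans ?_)
          rw [abs_mul]
          gcongr
          exact (abs_sub _ _).trans (by gcongr; exact hB a)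
      mgf_le := fun l => integral_exp_le_of_bounded_differences p hf hB hc l }
  have h1 := hsub.measure_ge_le hε
  have h2 := hsub.neg.measure_ge_le hε
  have hu : {X | ε ≤ |f X - m|} ⊆ {X | ε ≤ f X - m} ∪ {X | ε ≤ (-fun X => f X - m) X} := by
    intro X hX
    rcases le_abs.1 (show ε ≤ |f X - m| from hX) with h | h
    · exact Or.inl h
    · exact Or.inr h
  refine (measureReal_mono hu).trans ((measureReal_union_le _ _).trans ?_)
  exact (add_le_add h1 h2).trans_eq (two_mul _).symm

end BoundedDifferences
end RandomProductStates
end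

noncomputable section
namespace RandomProductStates
open Matrix

/-! ### The approximate Marčenko–Pastur equation for the mean. -/

section MeanEquation
variable {ι : Type*} [Fintype ι] [DecidableEq ι] {p : ℕ}

theorem continuous_inv_shiftedGram {t : ℝ} (ht : 0 < t) :
    Continuous fun X : Fin p → ι → ℂ => (shiftedGram X t)⁻¹ := by
  have hc : Continuous fun X : Fin p → ι → ℂ => shiftedGram X t := by
    unfold shiftedGram
    refine Continuous.add (continuous_finsetSum _ fun s _ => ?_) continuous_const
    exact Continuous.matrix_vecMulVec (continuous_apply s) (continuous_star.comp (continuous_apply s))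
  simp_rw [inv_def, Ring.inverse_eq_inv']
  exact (hc.matrix_det.inv₀ fun X => ((boundedBelow_shiftedGram X t).isUnit_det ht).ne_zero).smul
    hc.matrix_adjugate

theorem continuous_stieltjes {t : ℝ} (ht : 0 < t) :
    Continuous fun X : Fin p → ι → ℂ => stieltjes X t := by
  unfold stieltjes
  exact (Complex.continuous_re.comp (continuous_inv_shiftedGram ht).matrix_trace).div_const _

theorem continuous_quadForm_inv_shiftedGram {t : ℝ} (ht : 0 < t) :
    Continuous fun z : (ι → ℂ) × (Fin p → ι → ℂ) => quadForm (shiftedGram z.2 t)⁻¹ z.1 := by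
  unfold quadForm
  exact Complex.continuous_re.comp ((continuous_star.comp continuous_fst).dotProduct
    (((continuous_inv_shiftedGram ht).comp continuous_snd).matrix_mulVec continuous_fst))

theorem formBounded_inv_shiftedGram (X : Fin p → ι → ℂ) {t : ℝ} (ht : 0 < t) :
    FormBounded (shiftedGram X t)⁻¹ t⁻¹ where
  isHermitian := (boundedBelow_shiftedGram X t).isHermitian_inv
  abs_quadForm_le v := by
    rw [abs_of_nonneg ((boundedBelow_shiftedGram X t).quadForm_inv_nonneg ht v)]
    exact (boundedBelow_shiftedGram X t).quadForm_inv_le ht v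

/-- The map `a ↦ a / (1 + a)` is 1-Lipschitz on the half-line. As it is also bounded by `1`, the
unbounded forms `q_s` can be handled with second moments alone. -/
theorem abs_div_one_add_sub_le {a b : ℝ} (ha : 0 ≤ a) (hb : 0 ≤ b) :
    |a / (1 + a) - b / (1 + b)| ≤ |a - b| := by
  have : a / (1 + a) - b / (1 + b) = (a - b) / ((1 + a) * (1 + b)) := by field_simp; ring
  rw [this, abs_div, abs_of_pos (by positivity : 0 < (1 + a) * (1 + b))]
  refine div_le_self (abs_nonneg _) ?_
  nlinarith [mul_nonneg ha hb]

theorem abs_div_one_add_le {a : ℝ} (ha : 0 ≤ a) : |a / (1 + a)| ≤ 1 := by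
  rw [abs_of_nonneg (by positivity), div_le_one (by positivity)]
  linarith

/-- The first absolute moment is at most the square root of the second moment. -/
theorem integral_abs_le_sqrt {α : Type*} [MeasurableSpace α] {ν : Measure α}
    [IsProbabilityMeasure ν] {f : α → ℝ} (hf : Measurable f) {B : ℝ} (hB : ∀ a, |f a| ≤ B) :
    ∫ a, |f a| ∂ν ≤ √(∫ a, f a ^ 2 ∂ν) := by
  apply Real.le_sqrt_of_sq_le
  have h1 : Integrable (fun a => |f a|) ν :=
    integrable_of_abs_le (by fun_prop) fun a => by rw [abs_abs]; exact hB a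
  have h2 : Integrable (fun a => f a ^ 2) ν :=
    integrable_of_abs_le (B := B ^ 2) (by fun_prop) fun a => by
      rw [abs_pow]; exact pow_le_pow_left₀ (abs_nonneg _) (hB a) 2
  set m := ∫ a, |f a| ∂ν with hm
  have h3 : 0 ≤ ∫ a, (f a ^ 2 - 2 * m * |f a| + m ^ 2) ∂ν :=
    integral_nonneg fun a => by
      have : f a ^ 2 - 2 * m * |f a| + m ^ 2 = (|f a| - m) ^ 2 := by rw [← sq_abs (f a)]; ring
      simp only [this]
      positivity
  have h4 : Integrable (fun a => f a ^ 2 - 2 * m * |f a|) ν := h2.sub (h1.const_mul _)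
  rw [integral_add h4 (integrable_const _), integral_sub h2 (h1.const_mul _), integral_const_mul,
    ← hm] at h3
  simp at h3
  nlinarith

variable {Q : Measure (ι → ℂ)} {κ : ℝ}

/-- Combines the Lipschitz bound, `E|f| ≤ √(E f²)`, and concentration applied to a resolvent, whose
form bound is `1 / t`. The vectors `X` are frozen, as they are independent of `v` in the
application. -/
theorem QuadraticConcentration.integral_abs_sub_le (h : QuadraticConcentration Q κ) (hκ : 0 ≤ κ)
    (X : Fin p → ι → ℂ) {t : ℝ} (ht : 0 < t) :
    ∫ v, |quadForm (shiftedGram X t)⁻¹ v / (1 + quadForm (shiftedGram X t)⁻¹ v) -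
      stieltjes X t / (1 + stieltjes X t)| ∂Q ≤ √κ / t := by
  have := h.isProbabilityMeasure
  have hq := (boundedBelow_shiftedGram X t).quadForm_inv_nonneg ht
  have hS := stieltjes_nonneg X ht
  have hm := (continuous_quadForm (shiftedGram X t)⁻¹).measurable
  have hB : ∀ v, |quadForm (shiftedGram X t)⁻¹ v / (1 + quadForm (shiftedGram X t)⁻¹ v) -
      stieltjes X t / (1 + stieltjes X t)| ≤ 2 := fun v =>
    (abs_sub _ _).trans (by linarith [abs_div_one_add_le (hq v), abs_div_one_add_le hS])
  have hmeas : Measurable fun v => quadForm (shiftedGram X t)⁻¹ v /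
      (1 + quadForm (shiftedGram X t)⁻¹ v) - stieltjes X t / (1 + stieltjes X t) := by fun_prop
  refine (integral_abs_le_sqrt hmeas hB).trans ?_
  have e : √κ / t = √(κ * t⁻¹ ^ 2) := by
    rw [Real.sqrt_mul hκ, Real.sqrt_sq (by positivity)]; rfl
  rw [e]
  apply Real.sqrt_le_sqrt
  rw [← ENNReal.ofReal_le_ofReal_iff (by positivity), ofReal_integral_eq_lintegral_ofReal
    (integrable_of_abs_le (B := 2 ^ 2) (hmeas.pow_const 2) fun v => by
      rw [abs_pow]; exact pow_le_pow_left₀ (abs_nonneg _) (hB v) 2)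
    (ae_of_all _ fun v => sq_nonneg _)]
  refine (lintegral_mono fun v => ENNReal.ofReal_le_ofReal ?_).trans
    (h.lintegral_le _ _ (formBounded_inv_shiftedGram X ht))
  rw [← sq_abs, ← sq_abs (_ - _ / _)]
  exact pow_le_pow_left₀ (abs_nonneg _) (abs_div_one_add_sub_le (hq v) hS) 2

theorem abs_stieltjes_sub_removeNth_le (X : Fin (p + 1) → ι → ℂ) (s : Fin (p + 1)) {t : ℝ}
    (ht : 0 < t) : |stieltjes (s.removeNth X) t - stieltjes X t| ≤ t⁻¹ / Fintype.card ι := by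
  rw [abs_of_nonneg (sub_nonneg.2 (stieltjes_le_removeNth X s ht))]
  linarith [removeNth_le_stieltjes X s ht]

/-- Both values lie in the same interval of length `1 / (t N)`, whose upper end is the value with
the `s`-th vector removed; hence no factor `2`. -/
theorem abs_stieltjes_sub_update_le (X : Fin p → ι → ℂ) (s : Fin p) (y : ι → ℂ) {t : ℝ}
    (ht : 0 < t) :
    |stieltjes X t - stieltjes (Function.update X s y) t| ≤ t⁻¹ / Fintype.card ι := by
  obtain _ | p := p
  · exact s.elim0
  have h1 := stieltjes_le_removeNth X s ht
  have h2 := removeNth_le_stieltjes X s ht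
  have h3 := stieltjes_le_removeNth (Function.update X s y) s ht
  have h4 := removeNth_le_stieltjes (Function.update X s y) s ht
  rw [Fin.removeNth_update] at h3 h4
  rw [abs_le]
  constructor <;> linarith

variable [Nonempty ι]

/-- The expectation of the normalized resolvent trace. -/
def meanStieltjes (Q : Measure (ι → ℂ)) (p : ℕ) (t : ℝ) : ℝ :=
  ∫ X, stieltjes X t ∂(Measure.pi fun _ : Fin p => Q)

theorem abs_stieltjes_le (X : Fin p → ι → ℂ) {t : ℝ} (ht : 0 < t) : |stieltjes X t| ≤ t⁻¹ := by
  rw [abs_of_nonneg (stieltjes_nonneg X ht)]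
  exact stieltjes_le X ht

theorem measure_abs_stieltjes_sub_ge_le [IsProbabilityMeasure Q] (hp : 0 < p) {t : ℝ} (ht : 0 < t)
    {ε : ℝ} (hε : 0 ≤ ε) :
    (Measure.pi fun _ : Fin p => Q).real {X | ε ≤ |stieltjes X t - meanStieltjes Q p t|} ≤
      2 * Real.exp (-ε ^ 2 / (2 * (p * (t⁻¹ / Fintype.card ι) ^ 2))) := by
  have hN : (0 : ℝ) < Fintype.card ι := by exact_mod_cast Fintype.card_pos
  exact measure_abs_sub_ge_le (continuous_stieltjes ht).measurable
    (fun X => abs_stieltjes_le X ht) (fun X s y => abs_stieltjes_sub_update_le X s y ht)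
    (by positivity) hε

/-- From `l |y| ≤ exp (l y) + exp (-l y)` and the exponential bounds for `l` and `-l`. The parameter
is later taken to be the square root of the dimension, which balances the estimate. -/
theorem integral_abs_stieltjes_sub_le [IsProbabilityMeasure Q] {t : ℝ} (ht : 0 < t) {l : ℝ}
    (hl : 0 < l) :
    ∫ X, |stieltjes X t - meanStieltjes Q p t| ∂(Measure.pi fun _ : Fin p => Q) ≤
      2 * Real.exp (p * (t⁻¹ / Fintype.card ι) ^ 2 * l ^ 2 / 2) / l := by
  set m := meanStieltjes Q p t with hm
  have hmeas := (continuous_stieltjes (ι := ι) (p := p) ht).measurable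
  have he := fun l : ℝ => integral_exp_le_of_bounded_differences (Q := Q) p hmeas
    (fun X => abs_stieltjes_le X ht) (fun X s y => abs_stieltjes_sub_update_le X s y ht) l
  have hbd : ∀ X : Fin p → ι → ℂ, |stieltjes X t - m| ≤ t⁻¹ + |m| := fun X =>
    (abs_sub _ _).trans (by gcongr; exact abs_stieltjes_le X ht)
  have hint : ∀ l : ℝ, Integrable (fun X : Fin p → ι → ℂ => Real.exp (l * (stieltjes X t - m)))
      (Measure.pi fun _ => Q) := fun l =>
    integrable_of_abs_le (B := Real.exp (|l| * (t⁻¹ + |m|))) (by fun_prop) fun X => by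
      rw [Real.abs_exp]
      refine Real.exp_le_exp.2 ((le_abs_self _).trans ?_)
      rw [abs_mul]
      gcongr
      exact hbd X
  have h1 := he l
  have h2 := he (-l)
  rw [neg_sq] at h2
  change ∫ X, Real.exp (l * (stieltjes X t - m)) ∂_ ≤ _ at h1
  change ∫ X, Real.exp (-l * (stieltjes X t - m)) ∂_ ≤ _ at h2
  calc _ ≤ ∫ X, (Real.exp (l * (stieltjes X t - m)) + Real.exp (-l * (stieltjes X t - m))) / l
        ∂(Measure.pi fun _ : Fin p => Q) := by
        refine integral_mono_of_nonneg (ae_of_all _ fun X => abs_nonneg _)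
          (((hint l).add (hint (-l))).div_const l) (ae_of_all _ fun X => ?_)
        simp only
        rw [le_div_iff₀ hl]
        have e1 := Real.add_one_le_exp (l * (stieltjes X t - m))
        have e2 := Real.add_one_le_exp (-l * (stieltjes X t - m))
        have e3 := Real.exp_pos (l * (stieltjes X t - m))
        have e4 := Real.exp_pos (-l * (stieltjes X t - m))
        rcases abs_cases (stieltjes X t - m) with ⟨h, _⟩ | ⟨h, _⟩ <;> rw [h] <;> nlinarith
    _ ≤ _ := by
        rw [integral_div, integral_add (hint l) (hint (-l))]
        gcongr
        linarith

/-- The expected resolvent trace satisfies the Marčenko–Pastur equation up to a small error. -/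
theorem QuadraticConcentration.abs_mean_equation_le (h : QuadraticConcentration Q κ) (hκ : 0 ≤ κ)
    (hp : 0 < p) {t : ℝ} (ht : 0 < t) :
    |t * meanStieltjes Q p t + p / Fintype.card ι *
      (meanStieltjes Q p t / (1 + meanStieltjes Q p t)) - 1| ≤
      p / Fintype.card ι * (√κ / t + t⁻¹ / Fintype.card ι +
        ∫ X, |stieltjes X t - meanStieltjes Q p t| ∂(Measure.pi fun _ : Fin p => Q)) := by
  have := h.isProbabilityMeasure
  obtain ⟨p, rfl⟩ := Nat.exists_eq_succ_of_ne_zero hp.ne'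
  rw [Nat.succ_eq_add_one]
  set N : ℝ := ((Fintype.card ι : ℕ) : ℝ) with hN
  have hNpos : 0 < N := by rw [hN]; exact_mod_cast Fintype.card_pos
  set m := meanStieltjes Q (p + 1) t with hm
  set ν : Measure (Fin (p + 1) → ι → ℂ) := Measure.pi fun _ => Q with hν
  set σ := ∫ X, |stieltjes X t - m| ∂ν with hσ
  have hm0 : 0 ≤ m := integral_nonneg fun X => stieltjes_nonneg X ht
  set q : Fin (p + 1) → (Fin (p + 1) → ι → ℂ) → ℝ := fun s X =>
    quadForm (shiftedGram (s.removeNth X) t)⁻¹ (X s) with hq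
  have hq0 : ∀ s X, 0 ≤ q s X := fun s X =>
    (boundedBelow_shiftedGram _ t).quadForm_inv_nonneg ht _
  have hrem : ∀ s : Fin (p + 1), Continuous fun X : Fin (p + 1) → ι → ℂ => s.removeNth X :=
    fun s => by unfold Fin.removeNth; fun_prop
  have hqm : ∀ s, Measurable (q s) := fun s =>
    ((continuous_quadForm_inv_shiftedGram ht).comp
      ((continuous_apply s).prodMk (hrem s))).measurable
  have hSm := (continuous_stieltjes (ι := ι) (p := p + 1) ht).measurable
  have hSrm : ∀ s : Fin (p + 1), Measurable fun X : Fin (p + 1) → ι → ℂ =>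
      stieltjes (s.removeNth X) t := fun s => ((continuous_stieltjes ht).comp (hrem s)).measurable
  have hSi : Integrable (fun X : Fin (p + 1) → ι → ℂ => stieltjes X t) ν :=
    integrable_of_abs_le hSm fun X => abs_stieltjes_le X ht
  have hqi : ∀ s, Integrable (fun X => q s X / (1 + q s X)) ν := fun s =>
    integrable_of_abs_le (B := 1) (by have := hqm s; fun_prop) fun X => abs_div_one_add_le (hq0 s X)
  have hmean : t * m + (∑ s, ∫ X, q s X / (1 + q s X) ∂ν) / N = 1 := by
    have e := integral_congr_ae (μ := ν) (ae_of_all _ fun X => stieltjes_identity X ht)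
    rw [integral_add (hSi.const_mul t)
      ((integrable_finsetSum _ fun s _ => hqi s).div_const _), integral_const_mul, integral_div,
      integral_finsetSum _ fun s _ => hqi s] at e
    refine e.trans ?_
    simp
  -- Three errors arise: replacing `q_s` by the trace without the `s`-th vector (concentration),
  -- reinserting that vector (rank-one bound), and replacing the trace by its mean (fluctuation
  -- `σ`).
  have hterm : ∀ s, |∫ X, q s X / (1 + q s X) ∂ν - m / (1 + m)| ≤ √κ / t + t⁻¹ / N + σ := by
    intro s
    set S' : (Fin (p + 1) → ι → ℂ) → ℝ := fun X => stieltjes (s.removeNth X) t with hS'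
    have hS'0 : ∀ X, 0 ≤ S' X := fun X => stieltjes_nonneg _ ht
    have hb : ∀ X, |q s X / (1 + q s X) - S' X / (1 + S' X)| ≤ 2 := fun X =>
      (abs_sub _ _).trans (by linarith [abs_div_one_add_le (hq0 s X), abs_div_one_add_le (hS'0 X)])
    have hbm : Measurable fun X => q s X / (1 + q s X) - S' X / (1 + S' X) := by
      have := hqm s; have := hSrm s; fun_prop
    have i1 : Integrable (fun X => |q s X / (1 + q s X) - S' X / (1 + S' X)|) ν :=
      integrable_of_abs_le (B := 2) (by fun_prop) fun X => by rw [abs_abs]; exact hb X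
    have i2 : Integrable (fun X => |stieltjes X t - m|) ν := (hSi.sub (integrable_const _)).abs
    have h1 : ∫ X, |q s X / (1 + q s X) - S' X / (1 + S' X)| ∂ν ≤ √κ / t := by
      -- Fubini with the `s`-th vector separated from the others: the inner integral is over that
      -- vector, with the resolvent fixed.
      set e := MeasurableEquiv.piFinSuccAbove (fun _ : Fin (p + 1) => ι → ℂ) s with he
      have hmp := measurePreserving_piFinSuccAbove (fun _ : Fin (p + 1) => Q) s
      set F : (ι → ℂ) × (Fin p → ι → ℂ) → ℝ := fun z =>
        |quadForm (shiftedGram z.2 t)⁻¹ z.1 / (1 + quadForm (shiftedGram z.2 t)⁻¹ z.1) -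
          stieltjes z.2 t / (1 + stieltjes z.2 t)| with hF
      have hFe : ∀ X, |q s X / (1 + q s X) - S' X / (1 + S' X)| = F (e X) := fun X => rfl
      have hFm : Measurable F := by
        have := (continuous_quadForm_inv_shiftedGram (ι := ι) (p := p) ht).measurable
        have := ((continuous_stieltjes (ι := ι) (p := p) ht).comp
          (continuous_snd (X := ι → ℂ))).measurable
        simp only [Function.comp_def] at this
        fun_prop
      have hFi : Integrable F (Q.prod (Measure.pi fun _ : Fin p => Q)) :=
        integrable_of_abs_le (B := 2) hFm fun z => by
          rw [abs_abs]
          refine (abs_sub _ _).trans ?_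
          linarith [abs_div_one_add_le ((boundedBelow_shiftedGram z.2 t).quadForm_inv_nonneg ht z.1),
            abs_div_one_add_le (stieltjes_nonneg z.2 ht)]
      simp_rw [hFe]
      rw [hmp.integral_comp e.measurableEmbedding, integral_prod_symm _ hFi]
      calc _ ≤ ∫ _X, √κ / t ∂(Measure.pi fun _ : Fin p => Q) :=
            integral_mono_of_nonneg (ae_of_all _ fun X => integral_nonneg fun v => abs_nonneg _)
              (integrable_const _) (ae_of_all _ fun X => h.integral_abs_sub_le hκ X ht)
        _ = _ := by simp
    have hpt : ∀ X, |q s X / (1 + q s X) - m / (1 + m)| ≤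
        |q s X / (1 + q s X) - S' X / (1 + S' X)| + t⁻¹ / N + |stieltjes X t - m| := fun X => by
      have e1 := abs_div_one_add_sub_le (hS'0 X) hm0
      have e2 := abs_stieltjes_sub_removeNth_le X s ht
      have e3 := abs_sub_le (S' X) (stieltjes X t) m
      have e4 := abs_sub_le (q s X / (1 + q s X)) (S' X / (1 + S' X)) (m / (1 + m))
      linarith
    calc |∫ X, q s X / (1 + q s X) ∂ν - m / (1 + m)|
        = |∫ X, (q s X / (1 + q s X) - m / (1 + m)) ∂ν| := by
          rw [integral_sub (hqi s) (integrable_const _)]; simp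
      _ ≤ ∫ X, |q s X / (1 + q s X) - m / (1 + m)| ∂ν := abs_integral_le_integral_abs
      _ ≤ ∫ X, (|q s X / (1 + q s X) - S' X / (1 + S' X)| + t⁻¹ / N + |stieltjes X t - m|) ∂ν :=
          integral_mono_of_nonneg (ae_of_all _ fun X => abs_nonneg _)
            ((i1.add (integrable_const _)).add i2) (ae_of_all _ hpt)
      _ ≤ _ := by
          have i3 : Integrable (fun X => |q s X / (1 + q s X) - S' X / (1 + S' X)| + t⁻¹ / N) ν :=
            i1.add (integrable_const _)
          rw [integral_add i3 i2, integral_add i1 (integrable_const _)]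
          simp only [integral_const, probReal_univ, one_smul]
          linarith
  have e : t * m + ((p + 1 : ℕ) : ℝ) / N * (m / (1 + m)) - 1 =
      -(∑ s : Fin (p + 1), (∫ X, q s X / (1 + q s X) ∂ν - m / (1 + m))) / N := by
    rw [Finset.sum_sub_distrib]
    simp only [Finset.sum_const, Finset.card_univ, Fintype.card_fin, nsmul_eq_mul]
    linear_combination hmean
  rw [e, abs_div, abs_neg, abs_of_pos hNpos, div_mul_eq_mul_div]
  gcongr
  refine (Finset.abs_sum_le_sum_abs _ _).trans ?_
  refine (Finset.sum_le_sum fun s _ => hterm s).trans_eq ?_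
  simp only [Finset.sum_const, Finset.card_univ, Fintype.card_fin, nsmul_eq_mul]

end MeanEquation
end RandomProductStates
end

noncomputable section
namespace RandomProductStates
open Matrix

/-! ### Solving the limiting equation and almost sure convergence. -/

section Limit

/-- The Stieltjes transform at `-t` of the Marčenko–Pastur law with parameter `x`. -/
def mpStieltjes (x t : ℝ) : ℝ := (√((t + x - 1) ^ 2 + 4 * t) - (t + x - 1)) / (2 * t)

theorem mpStieltjes_pos (x : ℝ) {t : ℝ} (ht : 0 < t) : 0 < mpStieltjes x t := by
  unfold mpStieltjes
  refine div_pos (sub_pos.2 ?_) (by positivity)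
  exact Real.lt_sqrt_of_sq_lt (by linarith)

theorem mpStieltjes_equation (x : ℝ) {t : ℝ} (ht : 0 < t) :
    t * mpStieltjes x t + x * (mpStieltjes x t / (1 + mpStieltjes x t)) = 1 := by
  have hs := mpStieltjes_pos x ht
  have h : √((t + x - 1) ^ 2 + 4 * t) = 2 * t * mpStieltjes x t + (t + x - 1) := by
    unfold mpStieltjes; field_simp; ring
  have h2 := Real.sq_sqrt (show 0 ≤ (t + x - 1) ^ 2 + 4 * t by positivity)
  rw [h] at h2
  have h3 : 4 * t * (t * mpStieltjes x t ^ 2 + (t + x - 1) * mpStieltjes x t - 1) = 0 := by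
    linear_combination h2
  have h4 := (mul_eq_zero.1 h3).resolve_left (by positivity)
  field_simp
  linear_combination h4

/-- On the half-line `m ↦ t m + x m / (1 + m)` has all difference quotients at least `t`, and it
takes the value `1` at `mpStieltjes x t`. This stability turns an approximate equation into
convergence. -/
theorem mul_abs_sub_mpStieltjes_le {x : ℝ} (hx : 0 < x) {t : ℝ} (ht : 0 < t) {m : ℝ} (hm : 0 ≤ m) :
    t * |m - mpStieltjes x t| ≤ |t * m + x * (m / (1 + m)) - 1| := by
  have hs := mpStieltjes_pos x ht
  have he := mpStieltjes_equation x ht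
  set s := mpStieltjes x t
  have e : t * m + x * (m / (1 + m)) - (t * s + x * (s / (1 + s))) =
      (m - s) * (t + x / ((1 + m) * (1 + s))) := by field_simp; ring
  rw [he] at e
  rw [e, abs_mul, mul_comm]
  gcongr
  exact (le_add_of_nonneg_right (by positivity)).trans (le_abs_self _)

variable {ι : ℕ → Type*} [∀ n, Fintype (ι n)] [∀ n, DecidableEq (ι n)] [∀ n, Nonempty (ι n)]
  {p : ℕ → ℕ} {Q : ∀ n, Measure (ι n → ℂ)} {κ : ℕ → ℝ} {x : ℝ}

theorem tendsto_meanStieltjes (hx : 0 < x)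
    (hcard : Tendsto (fun n => (Fintype.card (ι n) : ℝ)) atTop atTop)
    (hp : Tendsto (fun n => (p n : ℝ) / Fintype.card (ι n)) atTop (𝓝 x))
    (hκ0 : ∀ n, 0 ≤ κ n) (hκ : Tendsto κ atTop (𝓝 0))
    (hQ : ∀ᶠ n in atTop, QuadraticConcentration (Q n) (κ n)) {t : ℝ} (ht : 0 < t) :
    Tendsto (fun n => meanStieltjes (Q n) (p n) t) atTop (𝓝 (mpStieltjes x t)) := by
  set N : ℕ → ℝ := fun n => Fintype.card (ι n) with hN
  have hNpos : ∀ n, 0 < N n := fun n => by simp only [hN]; exact_mod_cast Fintype.card_pos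
  have hppos : ∀ᶠ n in atTop, 0 < p n := by
    filter_upwards [hp.eventually (lt_mem_nhds hx)] with n hn
    rcases Nat.eq_zero_or_pos (p n) with h | h
    · simp [h] at hn
    · exact h
  -- The error of the mean equation, with the fluctuation bounded at `l = √N`, plus the cost of
  -- replacing `p / N` by `x`, all divided by the slope `t`.
  set err : ℕ → ℝ := fun n => (p n / N n * (√(κ n) / t + t⁻¹ / N n +
    2 * Real.exp (p n / N n * t⁻¹ ^ 2 / 2) / √(N n)) + |x - p n / N n|) / t with herr
  have herr0 : Tendsto err atTop (𝓝 0) := by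
    have h1 : Tendsto (fun n => √(κ n) / t) atTop (𝓝 0) := by
      have := (Real.continuous_sqrt.tendsto 0).comp hκ
      simpa using this.div_const t
    have h2 : Tendsto (fun n => t⁻¹ / N n) atTop (𝓝 0) := hcard.const_div_atTop _
    have h3 : Tendsto (fun n => 2 * Real.exp (p n / N n * t⁻¹ ^ 2 / 2) / √(N n)) atTop (𝓝 0) := by
      have e1 : Tendsto (fun n => 2 * Real.exp (p n / N n * t⁻¹ ^ 2 / 2)) atTop
          (𝓝 (2 * Real.exp (x * t⁻¹ ^ 2 / 2))) :=
        ((Real.continuous_exp.tendsto _).comp ((hp.mul_const _).div_const _)).const_mul 2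
      exact e1.div_atTop (Real.tendsto_sqrt_atTop.comp hcard)
    have h4 : Tendsto (fun n => |x - p n / N n|) atTop (𝓝 0) := by
      have := (hp.const_sub x).abs
      simpa using this
    have := ((hp.mul ((h1.add h2).add h3)).add h4).div_const t
    simpa [herr] using this
  rw [tendsto_iff_dist_tendsto_zero]
  refine squeeze_zero' (Eventually.of_forall fun n => dist_nonneg) ?_ herr0
  filter_upwards [hQ, hppos] with n hQn hpn
  have := hQn.isProbabilityMeasure
  set m := meanStieltjes (Q n) (p n) t with hm
  have hm0 : 0 ≤ m := integral_nonneg fun X => stieltjes_nonneg X ht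
  rw [Real.dist_eq]
  simp only [herr]
  rw [le_div_iff₀ ht, mul_comm]
  refine (mul_abs_sub_mpStieltjes_le hx ht hm0).trans ?_
  have h1 := hQn.abs_mean_equation_le (hκ0 n) hpn ht
  have h2 := integral_abs_stieltjes_sub_le (Q := Q n) (p := p n) ht (Real.sqrt_pos.2 (hNpos n))
  rw [Real.sq_sqrt (hNpos n).le] at h2
  have e1 : (p n : ℝ) * (t⁻¹ / Fintype.card (ι n)) ^ 2 * N n / 2 = p n / N n * t⁻¹ ^ 2 / 2 := by
    have := (hNpos n).ne'
    simp only [hN] at this ⊢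
    field_simp
  rw [e1] at h2
  have h3 : |t * m + x * (m / (1 + m)) - 1| ≤ |t * m + p n / N n * (m / (1 + m)) - 1| +
      |x - p n / N n| := by
    have e2 : t * m + x * (m / (1 + m)) - 1 = (t * m + p n / N n * (m / (1 + m)) - 1) +
        (x - p n / N n) * (m / (1 + m)) := by ring
    rw [e2]
    refine (abs_add_le _ _).trans ?_
    refine add_le_add_right ?_ _
    rw [abs_mul]
    exact mul_le_of_le_one_right (abs_nonneg _) (abs_div_one_add_le hm0)
  refine h3.trans ?_
  gcongr
  refine h1.trans ?_
  have := (hNpos n)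
  simp only [hN] at this ⊢
  gcongr

/-- Almost sure convergence of the resolvent traces, for an arbitrary coupling of the matrices. -/
theorem ae_tendsto_stieltjes (hx : 0 < x) (hcard : ∀ n, n ≤ Fintype.card (ι n))
    (hp : Tendsto (fun n => (p n : ℝ) / Fintype.card (ι n)) atTop (𝓝 x))
    (hκ0 : ∀ n, 0 ≤ κ n) (hκ : Tendsto κ atTop (𝓝 0))
    (hQ : ∀ᶠ n in atTop, QuadraticConcentration (Q n) (κ n))
    {Ω : Type*} [MeasurableSpace Ω] {μ : Measure Ω} {X : ∀ n, Ω → Fin (p n) → ι n → ℂ}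
    (hX : ∀ n, AEMeasurable (X n) μ)
    (hlaw : ∀ᶠ n in atTop, μ.map (X n) = Measure.pi fun _ => Q n) {t : ℝ} (ht : 0 < t) :
    ∀ᵐ ω ∂μ, Tendsto (fun n => stieltjes (X n ω) t) atTop (𝓝 (mpStieltjes x t)) := by
  set N : ℕ → ℝ := fun n => Fintype.card (ι n) with hN
  have hNpos : ∀ n, 0 < N n := fun n => by simp only [hN]; exact_mod_cast Fintype.card_pos
  have hnN : ∀ n : ℕ, (n : ℝ) ≤ N n := fun n => by simp only [hN]; exact_mod_cast hcard n
  have hcard' : Tendsto N atTop atTop := tendsto_atTop_mono hnN tendsto_natCast_atTop_atTop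
  have hmean := tendsto_meanStieltjes hx hcard' hp hκ0 hκ hQ ht
  have hdev : ∀ ε : ℝ, 0 < ε → ∀ᵐ ω ∂μ, ∀ᶠ n in atTop,
      |stieltjes (X n ω) t - meanStieltjes (Q n) (p n) t| < ε := by
    intro ε hε
    -- McDiarmid's exponent is `ε² t² N² / (2 p)`; with `p ≤ 2 x N` and `n ≤ N` it is at least `a
    -- n`.
    set a : ℝ := ε ^ 2 * t ^ 2 / (4 * x) with ha
    have hapos : 0 < a := by positivity
    have hbound : ∀ᶠ n in atTop, μ {ω | ε ≤ |stieltjes (X n ω) t - meanStieltjes (Q n) (p n) t|} ≤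
        ENNReal.ofReal (2 * Real.exp (-a) ^ n) := by
      filter_upwards [hQ, hlaw, hp.eventually (lt_mem_nhds hx),
        hp.eventually (gt_mem_nhds (show x < 2 * x by linarith))] with n hQn hln hpn hpn2
      have := hQn.isProbabilityMeasure
      have hpp : 0 < p n := by
        rcases Nat.eq_zero_or_pos (p n) with h | h
        · simp [h] at hpn
        · exact h
      have hpp' : (0 : ℝ) < p n := by exact_mod_cast hpp
      have hmeas : MeasurableSet {Y : Fin (p n) → ι n → ℂ |
          ε ≤ |stieltjes Y t - meanStieltjes (Q n) (p n) t|} :=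
        measurableSet_le measurable_const
          ((((continuous_stieltjes ht).measurable).sub_const _).abs)
      have e : μ {ω | ε ≤ |stieltjes (X n ω) t - meanStieltjes (Q n) (p n) t|} =
          (Measure.pi fun _ : Fin (p n) => Q n) {Y : Fin (p n) → ι n → ℂ |
          ε ≤ |stieltjes Y t - meanStieltjes (Q n) (p n) t|} := by
        rw [← hln, Measure.map_apply_of_aemeasurable (hX n) hmeas]
        rfl
      rw [e, ← ofReal_measureReal]
      apply ENNReal.ofReal_le_ofReal
      refine (measure_abs_stieltjes_sub_ge_le hpp ht hε.le).trans ?_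
      rw [← Real.exp_nat_mul]
      gcongr
      rw [neg_div, mul_neg, neg_le_neg_iff, le_div_iff₀ (by have := hNpos n; positivity)]
      have h1 : (p n : ℝ) ≤ 2 * x * N n := by
        have := (div_lt_iff₀ (hNpos n)).1 hpn2
        exact this.le
      change n * a * (2 * (p n * (t⁻¹ / N n) ^ 2)) ≤ ε ^ 2
      calc n * a * (2 * (p n * (t⁻¹ / N n) ^ 2))
          ≤ N n * a * (2 * ((2 * x * N n) * (t⁻¹ / N n) ^ 2)) := by
            gcongr; exact hnN n
        _ = ε ^ 2 := by
            have := (hNpos n).ne'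
            rw [ha]
            field_simp
            ring
    obtain ⟨n₀, hn₀⟩ := eventually_atTop.1 hbound
    -- Borel–Cantelli in its summable direction, which needs no independence between different `n`.
    -- The events before `n₀` are replaced by the empty set, since the bound holds only eventually.
    have hsum : ∑' n, μ (if n₀ ≤ n then
        {ω | ε ≤ |stieltjes (X n ω) t - meanStieltjes (Q n) (p n) t|} else ∅) ≠ ∞ := by
      have hr : Summable fun n : ℕ => 2 * Real.exp (-a) ^ n :=
        (summable_geometric_of_lt_one (Real.exp_pos _).le
          (Real.exp_lt_one_iff.2 (by linarith))).mul_left 2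
      refine ne_top_of_le_ne_top hr.tsum_ofReal_ne_top (ENNReal.tsum_le_tsum fun n => ?_)
      split_ifs with h
      · exact hn₀ n h
      · simp
    filter_upwards [ae_eventually_notMem hsum] with ω hω
    filter_upwards [hω, eventually_ge_atTop n₀] with n hn hn'
    simpa [hn'] using hn
  have hall : ∀ᵐ ω ∂μ, ∀ j : ℕ, ∀ᶠ n in atTop,
      |stieltjes (X n ω) t - meanStieltjes (Q n) (p n) t| < 1 / ((j : ℝ) + 1) :=
    ae_all_iff.2 fun j => hdev _ (by positivity)
  filter_upwards [hall] with ω hω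
  have h0 : Tendsto (fun n => stieltjes (X n ω) t - meanStieltjes (Q n) (p n) t) atTop (𝓝 0) := by
    rw [Metric.tendsto_nhds]
    intro ε hε
    obtain ⟨j, hj⟩ := exists_nat_one_div_lt hε
    filter_upwards [hω j] with n hn
    rw [Real.dist_eq, sub_zero]
    exact hn.trans hj
  simpa using h0.add hmean

end Limit
end RandomProductStates
end

noncomputable section
namespace RandomProductStates

/-! ### The Stieltjes transform of the limit law. -/

section MarchenkoPastur

/-- The integral `∫ √((β - y)(y - α)) / y` over `[α, β]`. -/
theorem integral_sqrt_mul_div {α β : ℝ} (hα : 0 ≤ α) (hαβ : α < β) :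
    IntervalIntegrable (fun y => √((β - y) * (y - α)) / y) volume α β ∧
    ∫ y in α..β, √((β - y) * (y - α)) / y = Real.pi * ((α + β) / 2 - √(α * β)) := by
  obtain ⟨M, hM⟩ : ∃ M, M = (α + β) / 2 := ⟨_, rfl⟩
  obtain ⟨r, hr⟩ : ∃ r, r = (β - α) / 2 := ⟨_, rfl⟩
  rw [← hM]
  have hrpos : 0 < r := by rw [hr]; linarith
  have hβ : 0 < β := hα.trans_lt hαβ
  -- An explicit primitive, with `M` the midpoint and `r` the half-length of the interval. When `α =
  -- 0` the last term vanishes through its factor `√(α * β)`, so its singular argument at `y = 0`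
  -- does no harm.
  set G : ℝ → ℝ := fun y => √((β - y) * (y - α)) + M * Real.arcsin ((y - M) / r) -
    √(α * β) * Real.arcsin ((M * y - α * β) / (r * y)) with hG
  have hcont : ContinuousOn G (Set.Icc α β) := by
    refine ContinuousOn.sub (Continuous.continuousOn (by
      have := Real.continuous_arcsin; fun_prop)) ?_
    rcases hα.eq_or_lt with h | h
    · simp only [← h, zero_mul, Real.sqrt_zero]
      exact continuousOn_const
    · refine continuousOn_const.mul (Real.continuous_arcsin.comp_continuousOn
        (ContinuousOn.div (by fun_prop) (by fun_prop) fun y hy => ?_))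
      have : 0 < y := h.trans_le hy.1
      positivity
  have hderiv : ∀ y ∈ Set.Ioo α β, HasDerivAt G (√((β - y) * (y - α)) / y) y := by
    rintro y ⟨hy1, hy2⟩
    have hy : 0 < y := hα.trans_lt hy1
    obtain ⟨w, hw⟩ : ∃ w, w = √((β - y) * (y - α)) := ⟨_, rfl⟩
    rw [← hw]
    have hprod : 0 < (β - y) * (y - α) := mul_pos (by linarith) (by linarith)
    have hwpos : 0 < w := hw ▸ Real.sqrt_pos.2 hprod
    have hw2 : w ^ 2 = (β - y) * (y - α) := hw ▸ Real.sq_sqrt hprod.le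
    have d1 : HasDerivAt (fun y => √((β - y) * (y - α))) ((M - y) / w) y := by
      have := (((hasDerivAt_id y).const_sub β).mul ((hasDerivAt_id y).sub_const α)).sqrt hprod.ne'
      refine HasDerivAt.congr_deriv this ?_
      simp only [id, Pi.mul_apply]
      rw [← hw, hM]
      field_simp
      ring
    have d2 : HasDerivAt (fun y => M * Real.arcsin ((y - M) / r)) (M / w) y := by
      have e : √(1 - ((y - M) / r) ^ 2) = w / r := by
        rw [show 1 - ((y - M) / r) ^ 2 = (w / r) ^ 2 by
          rw [div_pow, div_pow, hw2]; field_simp; rw [hr, hM]; ring]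
        exact Real.sqrt_sq (by positivity)
      have h1 : (y - M) / r ≠ -1 := by
        rw [Ne, div_eq_iff hrpos.ne']; intro h; rw [hM, hr] at h; linarith
      have h2 : (y - M) / r ≠ 1 := by
        rw [Ne, div_eq_iff hrpos.ne']; intro h; rw [hM, hr] at h; linarith
      have := ((Real.hasDerivAt_arcsin h1 h2).comp y
        (((hasDerivAt_id y).sub_const M).div_const r)).const_mul M
      refine HasDerivAt.congr_deriv this ?_
      rw [e]
      field_simp
    have d3 : HasDerivAt (fun y => √(α * β) * Real.arcsin ((M * y - α * β) / (r * y)))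
        (α * β / (y * w)) y := by
      rcases hα.eq_or_lt with h | h
      · simp only [← h, zero_mul, Real.sqrt_zero, zero_div]
        exact hasDerivAt_const _ _
      · have hs : 0 < √(α * β) := Real.sqrt_pos.2 (by positivity)
        have hs2 : √(α * β) ^ 2 = α * β := Real.sq_sqrt (by positivity)
        have e0 : 1 - ((M * y - α * β) / (r * y)) ^ 2 = (√(α * β) * w / (r * y)) ^ 2 := by
          rw [div_pow, div_pow, mul_pow, mul_pow, hs2, hw2]; field_simp; rw [hr, hM]; ring
        have e : √(1 - ((M * y - α * β) / (r * y)) ^ 2) = √(α * β) * w / (r * y) := by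
          rw [e0]; exact Real.sqrt_sq (by positivity)
        have hpos : 0 < 1 - ((M * y - α * β) / (r * y)) ^ 2 := by rw [e0]; positivity
        have h1 : (M * y - α * β) / (r * y) ≠ -1 := by
          intro h; rw [h] at hpos; norm_num at hpos
        have h2 : (M * y - α * β) / (r * y) ≠ 1 := by
          intro h; rw [h] at hpos; norm_num at hpos
        have d := (((hasDerivAt_id y).const_mul M).sub_const (α * β)).div
          ((hasDerivAt_id y).const_mul r) (by simp only [id]; positivity)
        have := ((Real.hasDerivAt_arcsin h1 h2).comp y d).const_mul (√(α * β))
        refine HasDerivAt.congr_deriv this ?_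
        simp only [id]
        rw [e]
        field_simp
        ring
    have := (d1.add d2).sub d3
    refine HasDerivAt.congr_deriv this ?_
    -- The derivative is `(2 M y - y² - α β) / (y w)`, whose numerator is `w²`.
    have : α * β = 2 * M * y - y ^ 2 - w ^ 2 := by rw [hw2, hM]; ring
    rw [this]
    field_simp
    ring
  have hint : IntervalIntegrable (fun y => √((β - y) * (y - α)) / y) volume α β := by
    rw [intervalIntegrable_iff_integrableOn_Ioc_of_le hαβ.le]
    -- For `α = 0` the integrand is unbounded at the left end; integrability follows because it is a
    -- nonnegative derivative of a function continuous up to the boundary.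
    refine intervalIntegral.integrableOn_deriv_of_nonneg hcont hderiv fun y hy => ?_
    have : 0 < y := hα.trans_lt hy.1
    positivity
  refine ⟨hint, ?_⟩
  rw [intervalIntegral.integral_eq_sub_of_hasDerivAt_of_le hαβ.le hcont hderiv hint]
  have a1 : (β - M) / r = 1 := by rw [div_eq_one_iff_eq hrpos.ne', hM, hr]; ring
  have a2 : (α - M) / r = -1 := by rw [div_eq_iff hrpos.ne', hM, hr]; ring
  have a3 : (M * β - α * β) / (r * β) = 1 := by
    rw [div_eq_one_iff_eq (by positivity), hM, hr]; ring
  have a4 : √(α * β) * Real.arcsin ((M * α - α * β) / (r * α)) = √(α * β) * -(Real.pi / 2) := by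
    rcases hα.eq_or_lt with h | h
    · simp [← h]
    · rw [show (M * α - α * β) / (r * α) = -1 by
        rw [div_eq_iff (by positivity), hM, hr]; ring, Real.arcsin_neg_one]
  simp only [hG, sub_self, zero_mul, mul_zero, Real.sqrt_zero, a1, a2, a3, a4, Real.arcsin_one,
    Real.arcsin_neg_one]
  ring

theorem integral_sqrt_mul_div_add {a b c : ℝ} (hab : a < b) (hc : 0 ≤ a + c) :
    IntervalIntegrable (fun y => √((b - y) * (y - a)) / (y + c)) volume a b ∧
    ∫ y in a..b, √((b - y) * (y - a)) / (y + c) =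
      Real.pi * ((a + b) / 2 + c - √((a + c) * (b + c))) := by
  obtain ⟨h1, h2⟩ := integral_sqrt_mul_div hc (show a + c < b + c by linarith)
  have e : ∀ y, √((b + c - (y + c)) * (y + c - (a + c))) / (y + c) =
      √((b - y) * (y - a)) / (y + c) := fun y => by congr 2; ring
  constructor
  · have := h1.comp_add_right c
    simpa [e] using this
  · rw [← intervalIntegral.integral_comp_add_right] at h2
    simp_rw [e] at h2
    rw [h2]
    ring

variable {x : ℝ}

theorem measurable_marchenkoPasturDensity : Measurable (marchenkoPasturDensity x) := by
  have : marchenkoPasturDensity x = Set.indicator (Set.Icc ((1 - √x) ^ 2) ((1 + √x) ^ 2))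
    (fun t => √(((1 + √x) ^ 2 - t) * (t - (1 - √x) ^ 2)) / (2 * Real.pi * min x 1 * t)) := rfl
  rw [this]
  exact Measurable.indicator (by fun_prop) measurableSet_Icc

theorem integral_marchenkoPasturLaw (hx : 0 < x) (g : ℝ → ℝ) :
    ∫ y, g y ∂(marchenkoPasturLaw x : Measure ℝ) = (2 * Real.pi * min x 1)⁻¹ *
      ∫ y in (1 - √x) ^ 2..(1 + √x) ^ 2,
        g y * (√(((1 + √x) ^ 2 - y) * (y - (1 - √x) ^ 2)) / y) := by
  have hab : (1 - √x) ^ 2 ≤ (1 + √x) ^ 2 := by nlinarith [Real.sqrt_nonneg x]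
  have hmin : 0 < min x 1 := lt_min hx one_pos
  have e : (marchenkoPasturLaw x : Measure ℝ) =
    volume.withDensity fun t => ENNReal.ofReal (marchenkoPasturDensity x t) := rfl
  rw [e, integral_withDensity_eq_integral_toReal_smul
    measurable_marchenkoPasturDensity.ennreal_ofReal (ae_of_all _ fun _ => ENNReal.ofReal_lt_top),
    intervalIntegral.integral_of_le hab, ← integral_const_mul,
    ← integral_Icc_eq_integral_Ioc, ← integral_indicator measurableSet_Icc]
  congr 1
  funext y
  unfold marchenkoPasturDensity
  by_cases hy : y ∈ Set.Icc ((1 - √x) ^ 2) ((1 + √x) ^ 2)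
  · rw [Set.indicator_of_mem hy, Set.indicator_of_mem hy]
    have hy0 : 0 ≤ y := (sq_nonneg _).trans hy.1
    rw [ENNReal.toReal_ofReal (by positivity), smul_eq_mul, div_eq_mul_inv, mul_inv]
    ring
  · rw [Set.indicator_of_notMem hy, Set.indicator_of_notMem hy]
    simp

theorem isProbabilityMeasure_marchenkoPasturLaw (hx : 0 < x) :
    IsProbabilityMeasure (marchenkoPasturLaw x : Measure ℝ) := by
  have hs : 0 < √x := Real.sqrt_pos.2 hx
  have hs2 : √x ^ 2 = x := Real.sq_sqrt hx.le
  have hmin : 0 < min x 1 := lt_min hx one_pos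
  have h := integral_marchenkoPasturLaw hx fun _ => 1
  simp only [one_mul] at h
  rw [(integral_sqrt_mul_div (sq_nonneg (1 - √x))
    (by nlinarith : (1 - √x) ^ 2 < (1 + √x) ^ 2)).2, ← mul_pow,
    show (1 - √x) * (1 + √x) = 1 - x by linear_combination -hs2, Real.sqrt_sq_eq_abs] at h
  have h1 : ((1 - √x) ^ 2 + (1 + √x) ^ 2) / 2 - |1 - x| = 2 * min x 1 := by
    have : ((1 - √x) ^ 2 + (1 + √x) ^ 2) / 2 = 1 + x := by linear_combination hs2
    rw [this]
    rcases le_total x 1 with h | h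
    · rw [min_eq_left h, abs_of_nonneg (by linarith)]; ring
    · rw [min_eq_right h, abs_of_nonpos (by linarith)]; ring
  rw [h1] at h
  have h2 : (marchenkoPasturLaw x : Measure ℝ).real Set.univ = 1 := by
    rw [integral_const] at h
    simp only [smul_eq_mul, mul_one] at h
    rw [h]
    have := Real.pi_pos
    field_simp
  exact ⟨by
    rw [← ofReal_measureReal, h2, ENNReal.ofReal_one]⟩

theorem ae_nonneg_marchenkoPasturLaw : ∀ᵐ y ∂(marchenkoPasturLaw x : Measure ℝ), 0 ≤ y := by
  have e : (marchenkoPasturLaw x : Measure ℝ) =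
    volume.withDensity fun t => ENNReal.ofReal (marchenkoPasturDensity x t) := rfl
  rw [e, ae_withDensity_iff measurable_marchenkoPasturDensity.ennreal_ofReal]
  refine ae_of_all _ fun y hy => ?_
  by_contra hneg
  apply hy
  unfold marchenkoPasturDensity
  rw [Set.indicator_of_notMem fun h => hneg ((sq_nonneg _).trans h.1), ENNReal.ofReal_zero]

/-- The full Marčenko–Pastur law has an atom of mass `1 - min x 1` at `0`. The right side subtracts
its contribution and renormalizes, in the same form as `integral_inv_add_sumOfProjectors` does for
the matrices. -/
theorem integral_inv_add_marchenkoPasturLaw (hx : 0 < x) {t : ℝ} (ht : 0 < t) :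
    ∫ y, (y + t)⁻¹ ∂(marchenkoPasturLaw x : Measure ℝ) =
      (min x 1)⁻¹ * (mpStieltjes x t - (1 - min x 1) / t) := by
  have hs : 0 < √x := Real.sqrt_pos.2 hx
  have hs2 : √x ^ 2 = x := Real.sq_sqrt hx.le
  have hmin : 0 < min x 1 := lt_min hx one_pos
  have hpi := Real.pi_pos
  rw [integral_marchenkoPasturLaw hx]
  set a := (1 - √x) ^ 2 with ha
  set b := (1 + √x) ^ 2 with hb
  have ha0 : 0 ≤ a := sq_nonneg _
  have hab : a < b := by rw [ha, hb]; nlinarith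
  obtain ⟨i1, h1⟩ := integral_sqrt_mul_div_add (c := 0) hab (by linarith)
  obtain ⟨i2, h2⟩ := integral_sqrt_mul_div_add (c := t) hab (by linarith)
  -- Partial fractions reduce the integral to the shifts `c = 0` and `c = t`. The identity persists
  -- at `y = 0`, which is in the interval only if `a = 0`, since the square root vanishes there.
  have e : ∫ y in a..b, (y + t)⁻¹ * (√((b - y) * (y - a)) / y) =
      ∫ y in a..b, t⁻¹ * (√((b - y) * (y - a)) / (y + 0) - √((b - y) * (y - a)) / (y + t)) := by
    refine intervalIntegral.integral_congr fun y hy => ?_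
    rw [Set.uIcc_of_le hab.le] at hy
    have hy0 : 0 ≤ y := ha0.trans hy.1
    rcases hy0.eq_or_lt with h | h
    · have : a = 0 := le_antisymm (h ▸ hy.1) ha0
      simp [← h, this]
    · simp only [add_zero]
      field_simp
      ring
  rw [e, intervalIntegral.integral_const_mul, intervalIntegral.integral_sub i1 i2, h1, h2]
  have e1 : √((a + 0) * (b + 0)) = |1 - x| := by
    rw [add_zero, add_zero, ha, hb, ← mul_pow,
      show (1 - √x) * (1 + √x) = 1 - x by linear_combination -hs2, Real.sqrt_sq_eq_abs]
  have e2 : (a + t) * (b + t) = (t + x - 1) ^ 2 + 4 * t := by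
    rw [ha, hb]; linear_combination (√x ^ 2 + x + 2 * t - 2) * hs2
  rw [e1, e2, mpStieltjes]
  set D := √((t + x - 1) ^ 2 + 4 * t)
  rcases le_total x 1 with h | h
  · rw [min_eq_left h, abs_of_nonneg (by linarith)]
    field_simp
    ring
  · rw [min_eq_right h, abs_of_nonpos (by linarith)]
    field_simp
    ring

end MarchenkoPastur
end RandomProductStates
end

noncomputable section
namespace RandomProductStates

/-! ### From Stieltjes transforms to weak convergence. -/

section WeakConvergence

theorem inv_one_add_mem_Ioc {y : ℝ} (hy : 0 ≤ y) : (1 + y)⁻¹ ∈ Set.Ioc (0 : ℝ) 1 :=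
  ⟨by positivity, inv_le_one_of_one_le₀ (by linarith)⟩

theorem integrable_of_abs_le_of_nonneg {ν : Measure ℝ} [IsProbabilityMeasure ν]
    (hν : ∀ᵐ y ∂ν, 0 ≤ y) {f : ℝ → ℝ} (hf : Measurable f) {B : ℝ}
    (hB : ∀ y, 0 ≤ y → |f y| ≤ B) : Integrable f ν :=
  Integrable.of_bound hf.aestronglyMeasurable B (hν.mono fun y hy => hB y hy)

theorem abs_integral_le_of_nonneg {ν : Measure ℝ} [IsProbabilityMeasure ν]
    (hν : ∀ᵐ y ∂ν, 0 ≤ y) {f : ℝ → ℝ} {B : ℝ} (hB : ∀ y, 0 ≤ y → |f y| ≤ B) :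
    |∫ y, f y ∂ν| ≤ B := by
  have := norm_integral_le_of_norm_le_const (μ := ν) (f := f) (hν.mono fun y hy => hB y hy)
  simpa using this

/-- Expansion of the resolvent kernel in powers of `(1 + y)⁻¹`. -/
theorem abs_inv_sub_sum_le {y s : ℝ} (hy : 0 ≤ y) (hs : 0 < s) (hs2 : s ≤ 1 / 2) (j : ℕ) :
    |(y + (1 - s))⁻¹ - ∑ i ∈ Finset.range j, s ^ i * (1 + y)⁻¹ ^ (i + 1)| ≤ 2 * s ^ j := by
  obtain ⟨hz0, hz1⟩ := inv_one_add_mem_Ioc hy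
  have hd : 0 < y + (1 - s) := by linarith
  have e : ∀ j : ℕ, (y + (1 - s))⁻¹ - ∑ i ∈ Finset.range j, s ^ i * (1 + y)⁻¹ ^ (i + 1) =
      s ^ j * (1 + y)⁻¹ ^ j * (y + (1 - s))⁻¹ := by
    intro j
    induction j with
    | zero => simp
    | succ j ih =>
      rw [Finset.sum_range_succ, ← sub_sub, ih, pow_succ s j, pow_succ _ j]
      have : (1 + y)⁻¹ * (y + (1 - s))⁻¹ * s = (y + (1 - s))⁻¹ - (1 + y)⁻¹ := by
        have : 0 < 1 + y := by linarith
        field_simp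
        ring
      linear_combination -(s ^ j * (1 + y)⁻¹ ^ j) * this
  rw [e, abs_of_nonneg (by positivity)]
  have h1 : (1 + y)⁻¹ ^ j ≤ 1 := pow_le_one₀ hz0.le hz1
  have h2 : (y + (1 - s))⁻¹ ≤ 2 := by
    rw [inv_le_comm₀ hd (by norm_num)]; linarith
  calc s ^ j * (1 + y)⁻¹ ^ j * (y + (1 - s))⁻¹ ≤ s ^ j * 1 * 2 := by gcongr
    _ = _ := by ring

variable {ν : ℕ → Measure ℝ} {ν' : Measure ℝ} [∀ n, IsProbabilityMeasure (ν n)]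
  [IsProbabilityMeasure ν']

/-- Convergence of Stieltjes transforms implies convergence of the moments of `(1 + y)⁻¹`. -/
theorem tendsto_integral_inv_pow (hν : ∀ n, ∀ᵐ y ∂(ν n), 0 ≤ y) (hν' : ∀ᵐ y ∂ν', 0 ≤ y)
    (h : ∀ t : ℚ, 0 < t → Tendsto (fun n => ∫ y, (y + (t : ℝ))⁻¹ ∂(ν n)) atTop
      (𝓝 (∫ y, (y + (t : ℝ))⁻¹ ∂ν'))) (j : ℕ) :
    Tendsto (fun n => ∫ y, (1 + y)⁻¹ ^ j ∂(ν n)) atTop (𝓝 (∫ y, (1 + y)⁻¹ ^ j ∂ν')) := by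
  induction j using Nat.strong_induction_on with
  | _ j ih =>
    obtain _ | j := j
    · simp
    have hpow : ∀ (ν : Measure ℝ) [IsProbabilityMeasure ν], (∀ᵐ y ∂ν, 0 ≤ y) → ∀ i : ℕ,
        Integrable (fun y : ℝ => (1 + y)⁻¹ ^ i) ν := fun ν _ hν i =>
      integrable_of_abs_le_of_nonneg (B := 1) hν (by fun_prop) fun y hy => by
        obtain ⟨h0, h1⟩ := inv_one_add_mem_Ioc hy
        rw [abs_of_nonneg (by positivity)]
        exact pow_le_one₀ h0.le h1
    have happrox : ∀ s : ℝ, 0 < s → s ≤ 1 / 2 → ∀ (ν : Measure ℝ) [IsProbabilityMeasure ν],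
        (∀ᵐ y ∂ν, 0 ≤ y) → |∫ y, (y + (1 - s))⁻¹ ∂ν -
          ∑ i ∈ Finset.range (j + 1), s ^ i * ∫ y, (1 + y)⁻¹ ^ (i + 1) ∂ν| ≤ 2 * s ^ (j + 1) := by
      intro s hs hs2 ν _ hν
      have i1 : Integrable (fun y : ℝ => (y + (1 - s))⁻¹) ν :=
        integrable_of_abs_le_of_nonneg (B := (1 - s)⁻¹) hν (by fun_prop) fun y hy => by
          have : 0 < y + (1 - s) := by linarith
          rw [abs_of_nonneg (by positivity)]
          exact inv_anti₀ (by linarith) (by linarith)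
      have i2 : ∀ i ∈ Finset.range (j + 1),
          Integrable (fun y : ℝ => s ^ i * (1 + y)⁻¹ ^ (i + 1)) ν := fun i _ =>
        (hpow ν hν (i + 1)).const_mul _
      have := abs_integral_le_of_nonneg hν fun y hy => abs_inv_sub_sum_le hy hs hs2 (j + 1)
      rw [integral_sub i1 (integrable_finsetSum _ i2), integral_finsetSum _ i2] at this
      simpa only [integral_const_mul] using this
    rw [Metric.tendsto_nhds]
    intro ε hε
    -- At `t = 1 - s` the new moment enters with coefficient `s ^ j`, while the two truncation
    -- errors total `4 s ^ (j + 1)`. After division by `s ^ j` they contribute `4 s < ε / 2`; this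
    -- explains `ε / 8`. A rational `s` keeps `t` rational.
    obtain ⟨q, hq0, hq1⟩ := exists_rat_btwn (show (0 : ℝ) < min (1 / 2) (ε / 8) by positivity)
    set s : ℝ := (q : ℝ) with hs
    have hs2 : s ≤ 1 / 2 := hq1.le.trans (min_le_left _ _)
    have hs8 : s < ε / 8 := hq1.trans_le (min_le_right _ _)
    have h1 := h (1 - q) (by
      have : q < 1 := by exact_mod_cast (show (q : ℝ) < 1 by rw [← hs]; linarith)
      linarith)
    push_cast at h1
    rw [← hs] at h1
    have h2 : Tendsto (fun n => ∑ i ∈ Finset.range j, s ^ i * ∫ y, (1 + y)⁻¹ ^ (i + 1) ∂(ν n)) atTop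
        (𝓝 (∑ i ∈ Finset.range j, s ^ i * ∫ y, (1 + y)⁻¹ ^ (i + 1) ∂ν')) :=
      tendsto_finsetSum _ fun i hi => (ih (i + 1) (by
        have := Finset.mem_range.1 hi; omega)).const_mul _
    have h3 := h1.sub h2
    rw [Metric.tendsto_nhds] at h3
    filter_upwards [h3 (s ^ j * (ε / 2)) (by positivity)] with n hn
    have e1 := happrox s hq0 hs2 (ν n) (hν n)
    have e2 := happrox s hq0 hs2 ν' hν'
    rw [Finset.sum_range_succ] at e1 e2
    rw [Real.dist_eq] at hn ⊢
    set m := ∫ y, (1 + y)⁻¹ ^ (j + 1) ∂(ν n)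
    set m' := ∫ y, (1 + y)⁻¹ ^ (j + 1) ∂ν'
    have hsj : 0 < s ^ j := by positivity
    have h4 : s ^ j * |m - m'| < s ^ j * ε := by
      rw [← abs_of_pos hsj, ← abs_mul, abs_of_pos hsj]
      have h5 : 4 * s ^ (j + 1) ≤ s ^ j * (ε / 2) := by
        rw [pow_succ]
        nlinarith
      rw [abs_lt] at hn ⊢
      rw [abs_le] at e1 e2
      constructor <;> nlinarith [hn.1, hn.2, e1.1, e1.2, e2.1, e2.2]
    exact lt_of_mul_lt_mul_left h4 hsj.le

theorem tendsto_integral_eval_inv (hν : ∀ n, ∀ᵐ y ∂(ν n), 0 ≤ y) (hν' : ∀ᵐ y ∂ν', 0 ≤ y)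
    (h : ∀ j : ℕ, Tendsto (fun n => ∫ y, (1 + y)⁻¹ ^ j ∂(ν n)) atTop
      (𝓝 (∫ y, (1 + y)⁻¹ ^ j ∂ν'))) (P : Polynomial ℝ) :
    Tendsto (fun n => ∫ y, P.eval (1 + y)⁻¹ ∂(ν n)) atTop (𝓝 (∫ y, P.eval (1 + y)⁻¹ ∂ν')) := by
  have hpow : ∀ (ν : Measure ℝ) [IsProbabilityMeasure ν], (∀ᵐ y ∂ν, 0 ≤ y) → ∀ i : ℕ,
      Integrable (fun y : ℝ => P.coeff i * (1 + y)⁻¹ ^ i) ν := fun ν _ hν i =>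
    (integrable_of_abs_le_of_nonneg (B := 1) hν (by fun_prop) fun y hy => by
      obtain ⟨h0, h1⟩ := inv_one_add_mem_Ioc hy
      rw [abs_of_nonneg (by positivity)]
      exact pow_le_one₀ h0.le h1).const_mul _
  have e : ∀ (ν : Measure ℝ) [IsProbabilityMeasure ν], (∀ᵐ y ∂ν, 0 ≤ y) →
      ∫ y, P.eval (1 + y)⁻¹ ∂ν =
        ∑ i ∈ Finset.range (P.natDegree + 1), P.coeff i * ∫ y, (1 + y)⁻¹ ^ i ∂ν := by
    intro ν _ hν
    simp_rw [Polynomial.eval_eq_sum_range]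
    rw [integral_finsetSum _ fun i _ => hpow ν hν i]
    simp_rw [integral_const_mul]
  rw [e ν' hν']
  simp_rw [fun n => e (ν n) (hν n)]
  exact tendsto_finsetSum _ fun i _ => (h i).const_mul _

/-- Weierstrass approximation: `y ↦ (1 + y)⁻¹` maps the half-line into the compact interval `[0,
1]`. -/
theorem tendsto_integral_continuousOn_inv (hν : ∀ n, ∀ᵐ y ∂(ν n), 0 ≤ y) (hν' : ∀ᵐ y ∂ν', 0 ≤ y)
    (h : ∀ P : Polynomial ℝ, Tendsto (fun n => ∫ y, P.eval (1 + y)⁻¹ ∂(ν n)) atTop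
      (𝓝 (∫ y, P.eval (1 + y)⁻¹ ∂ν'))) {F : ℝ → ℝ} (hF : ContinuousOn F (Set.Icc 0 1))
    (hFm : Measurable F) :
    Tendsto (fun n => ∫ y, F (1 + y)⁻¹ ∂(ν n)) atTop (𝓝 (∫ y, F (1 + y)⁻¹ ∂ν')) := by
  obtain ⟨B, hB⟩ := isCompact_Icc.exists_bound_of_continuousOn hF
  rw [Metric.tendsto_nhds]
  intro ε hε
  obtain ⟨P, hP⟩ := exists_polynomial_near_of_continuousOn 0 1 F hF (ε / 4) (by positivity)
  have hmem : ∀ y : ℝ, 0 ≤ y → (1 + y)⁻¹ ∈ Set.Icc (0 : ℝ) 1 := fun y hy =>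
    Set.Ioc_subset_Icc_self (inv_one_add_mem_Ioc hy)
  have key : ∀ (ν : Measure ℝ) [IsProbabilityMeasure ν], (∀ᵐ y ∂ν, 0 ≤ y) →
      |∫ y, P.eval (1 + y)⁻¹ ∂ν - ∫ y, F (1 + y)⁻¹ ∂ν| ≤ ε / 4 := by
    intro ν _ hν
    have i1 : Integrable (fun y : ℝ => F (1 + y)⁻¹) ν :=
      integrable_of_abs_le_of_nonneg hν (by fun_prop) fun y hy => hB _ (hmem y hy)
    have i2 : Integrable (fun y : ℝ => P.eval (1 + y)⁻¹) ν :=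
      integrable_of_abs_le_of_nonneg (B := B + ε / 4) hν (by fun_prop) fun y hy => by
        have h1 := hP _ (hmem y hy)
        have h2 := hB _ (hmem y hy)
        rw [Real.norm_eq_abs] at h2
        have h3 := abs_sub_abs_le_abs_sub (P.eval (1 + y)⁻¹) (F (1 + y)⁻¹)
        linarith
    rw [← integral_sub i2 i1]
    exact abs_integral_le_of_nonneg hν fun y hy => (hP _ (hmem y hy)).le
  have h1 := h P
  rw [Metric.tendsto_nhds] at h1
  filter_upwards [h1 (ε / 4) (by positivity)] with n hn
  have e1 := key (ν n) (hν n)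
  have e2 := key ν' hν'
  rw [Real.dist_eq, abs_lt] at hn ⊢
  rw [abs_le] at e1 e2
  constructor <;> linarith [hn.1, hn.2, e1.1, e1.2, e2.1, e2.2]

open scoped BoundedContinuousFunction in
/-- Convergence of Stieltjes transforms at the negative rational numbers implies weak convergence
of probability measures on the half-line. -/
theorem tendsto_integral_of_tendsto_stieltjes (hν : ∀ n, ∀ᵐ y ∂(ν n), 0 ≤ y)
    (hν' : ∀ᵐ y ∂ν', 0 ≤ y)
    (h : ∀ t : ℚ, 0 < t → Tendsto (fun n => ∫ y, (y + (t : ℝ))⁻¹ ∂(ν n)) atTop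
      (𝓝 (∫ y, (y + (t : ℝ))⁻¹ ∂ν'))) (f : ℝ →ᵇ ℝ) :
    Tendsto (fun n => ∫ y, f y ∂(ν n)) atTop (𝓝 (∫ y, f y ∂ν')) := by
  have hpoly := tendsto_integral_eval_inv hν hν' (tendsto_integral_inv_pow hν hν' h)
  set C := ‖f‖ with hC
  have hfC : ∀ y, |f y| ≤ C := f.norm_coe_le_norm
  have hC0 : 0 ≤ C := norm_nonneg _
  have hfm : Measurable f := f.continuous.measurable
  have htail : Tendsto (fun m : ℕ => ∫ y, (1 - (1 + y)⁻¹) ^ m ∂ν') atTop (𝓝 0) := by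
    have := tendsto_integral_filter_of_dominated_convergence (μ := ν') (l := atTop)
      (F := fun (m : ℕ) (y : ℝ) => (1 - (1 + y)⁻¹) ^ m) (f := fun _ => 0) (fun _ => 1)
      (Eventually.of_forall fun m => Measurable.aestronglyMeasurable (by fun_prop))
      (Eventually.of_forall fun m => hν'.mono fun y hy => by
        obtain ⟨h0, h1⟩ := inv_one_add_mem_Ioc hy
        rw [Real.norm_eq_abs, abs_pow]
        exact pow_le_one₀ (abs_nonneg _) (abs_le.2 ⟨by linarith, by linarith⟩))
      (integrable_const _)
      (hν'.mono fun y hy => by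
        obtain ⟨h0, h1⟩ := inv_one_add_mem_Ioc hy
        exact tendsto_pow_atTop_nhds_zero_of_lt_one (by linarith) (by linarith))
    simpa using this
  rw [Metric.tendsto_nhds]
  intro ε hε
  obtain ⟨m, hm⟩ : ∃ m : ℕ, (C + 1) * ∫ y, (1 - (1 + y)⁻¹) ^ m ∂ν' < ε / 8 := by
    have h0 : (C + 1) * 0 < ε / 8 := by rw [mul_zero]; positivity
    exact ((htail.const_mul (C + 1)).eventually_lt_const h0).exists
  -- In the variable `z = (1 + y)⁻¹` the point at infinity is `z = 0`, where `f` need not have a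
  -- limit. The factor `1 - (1 - z) ^ m` vanishes there and makes `F` continuous on `[0, 1]`.
  set F : ℝ → ℝ := fun z => f (z⁻¹ - 1) * (1 - (1 - z) ^ m) with hF
  have hFm : Measurable F := by
    have := hfm.comp (measurable_inv.sub_const (1 : ℝ))
    simp only [hF]
    exact this.mul (by fun_prop)
  have hFc : ContinuousOn F (Set.Icc 0 1) := by
    intro z hz
    rcases hz.1.eq_or_lt with h0 | h0
    · subst h0
      have hF0 : F 0 = 0 := by simp [hF]
      rw [ContinuousWithinAt, hF0]
      have hb : Tendsto (fun z : ℝ => C * |1 - (1 - z) ^ m|) (𝓝[Set.Icc 0 1] 0) (𝓝 0) := by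
        have : Continuous fun z : ℝ => C * |1 - (1 - z) ^ m| := by fun_prop
        have := this.continuousWithinAt (s := Set.Icc 0 1) (x := 0)
        simpa [ContinuousWithinAt] using this
      refine squeeze_zero_norm (fun z => ?_) hb
      rw [Real.norm_eq_abs, abs_mul]
      gcongr
      exact hfC _
    · have : ContinuousAt F z := by
        have h1 : ContinuousAt (fun z : ℝ => z⁻¹ - 1) z :=
          (continuousAt_inv₀ h0.ne').sub continuousAt_const
        exact (f.continuous.continuousAt.comp h1).mul (by fun_prop)
      exact this.continuousWithinAt
  have hlimF := tendsto_integral_continuousOn_inv hν hν' hpoly hFc hFm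
  -- The cut-off error is at most `C` times the integral of `(1 - z) ^ m`. That is a polynomial in
  -- `z`, so its integrals converge too and the smallness under `ν'` passes to `ν n`; this replaces
  -- a separate tightness argument.
  have hlimT := hpoly ((1 - Polynomial.X) ^ m)
  simp only [Polynomial.eval_pow, Polynomial.eval_sub, Polynomial.eval_one, Polynomial.eval_X]
    at hlimT
  have key : ∀ (ν : Measure ℝ) [IsProbabilityMeasure ν], (∀ᵐ y ∂ν, 0 ≤ y) →
      |∫ y, f y ∂ν - ∫ y, F (1 + y)⁻¹ ∂ν| ≤ C * ∫ y, (1 - (1 + y)⁻¹) ^ m ∂ν := by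
    intro ν _ hν
    obtain ⟨B, hB⟩ := isCompact_Icc.exists_bound_of_continuousOn hFc
    have i1 : Integrable (fun y => f y) ν := f.integrable ν
    have i2 : Integrable (fun y : ℝ => F (1 + y)⁻¹) ν :=
      integrable_of_abs_le_of_nonneg hν (by fun_prop) fun y hy =>
        hB _ (Set.Ioc_subset_Icc_self (inv_one_add_mem_Ioc hy))
    have i3 : Integrable (fun y : ℝ => (1 - (1 + y)⁻¹) ^ m) ν :=
      integrable_of_abs_le_of_nonneg (B := 1) hν (by fun_prop) fun y hy => by
        obtain ⟨h0, h1⟩ := inv_one_add_mem_Ioc hy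
        rw [abs_pow]
        exact pow_le_one₀ (abs_nonneg _) (abs_le.2 ⟨by linarith, by linarith⟩)
    rw [← integral_sub i1 i2, ← integral_const_mul]
    refine abs_integral_le_integral_abs.trans (integral_mono_ae (i1.sub i2).abs (i3.const_mul C)
      (hν.mono fun y hy => ?_))
    obtain ⟨h0, h1⟩ := inv_one_add_mem_Ioc hy
    have e : f y - F (1 + y)⁻¹ = f y * (1 - (1 + y)⁻¹) ^ m := by
      simp only [hF, inv_inv, add_sub_cancel_left]
      ring
    simp only [e]
    rw [abs_mul, abs_of_nonneg (a := (1 - (1 + y)⁻¹) ^ m) (pow_nonneg (by linarith) _)]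
    exact mul_le_mul_of_nonneg_right (hfC y) (pow_nonneg (by linarith) _)
  rw [Metric.tendsto_nhds] at hlimF
  have hlimT' := (hlimT.const_mul (C + 1)).eventually (gt_mem_nhds hm)
  filter_upwards [hlimF (ε / 4) (by positivity), hlimT'] with n h1 h2
  have e1 := key (ν n) (hν n)
  have e2 := key ν' hν'
  have hpos : ∀ (ν : Measure ℝ) [IsProbabilityMeasure ν], (∀ᵐ y ∂ν, 0 ≤ y) →
      0 ≤ ∫ y, (1 - (1 + y)⁻¹) ^ m ∂ν := fun ν _ hν =>
    integral_nonneg_of_ae (hν.mono fun y hy =>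
      pow_nonneg (sub_nonneg.2 (inv_one_add_mem_Ioc hy).2) m)
  have p1 := hpos (ν n) (hν n)
  have p2 := hpos ν' hν'
  rw [Real.dist_eq, abs_lt] at h1 ⊢
  rw [abs_le] at e1 e2
  constructor <;> linarith [h1.1, h1.2, e1.1, e1.2, e2.1, e2.2]

end WeakConvergence
end RandomProductStates
end

noncomputable section
namespace RandomProductStates

/-! ### Removing the zero eigenvalues. -/

section NonzeroSpectrum

variable {ι : Type*} [Fintype ι] [DecidableEq ι] {A : Matrix ι ι ℂ}

theorem card_filter_eigenvalues_ne_zero (hA : A.IsHermitian) :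
    (Finset.univ.filter fun i => hA.eigenvalues i ≠ 0).card = A.rank := by
  rw [hA.rank_eq_card_non_zero_eigs, Fintype.card_subtype]

theorem toMeasure_nonzeroSpectralDistribution (hA : A.IsHermitian) :
    (nonzeroSpectralDistribution hA : Measure ℝ) =
      (A.rank : ℝ≥0)⁻¹ • ∑ i with hA.eigenvalues i ≠ 0, Measure.dirac (hA.eigenvalues i) := by
  rw [nonzeroSpectralDistribution, FiniteMeasure.toMeasure_smul, FiniteMeasure.toMeasure_sum]
  rfl

theorem integral_nonzeroSpectralDistribution (hA : A.IsHermitian) (f : ℝ → ℝ) :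
    ∫ y, f y ∂(nonzeroSpectralDistribution hA : Measure ℝ) =
      (A.rank : ℝ)⁻¹ * ∑ i with hA.eigenvalues i ≠ 0, f (hA.eigenvalues i) := by
  rw [toMeasure_nonzeroSpectralDistribution, integral_smul_nnreal_measure,
    integral_finsetSum_measure fun i _ => integrable_dirac (by simp)]
  simp [NNReal.smul_def]

theorem isProbabilityMeasure_nonzeroSpectralDistribution (hA : A.IsHermitian)
    (h : A.rank ≠ 0) : IsProbabilityMeasure (nonzeroSpectralDistribution hA : Measure ℝ) := by
  constructor
  rw [toMeasure_nonzeroSpectralDistribution, Measure.smul_apply, Measure.finsetSum_apply]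
  simp only [measure_univ, Finset.sum_const, card_filter_eigenvalues_ne_zero]
  rw [ENNReal.smul_def, smul_eq_mul, ENNReal.coe_inv (by exact_mod_cast h)]
  simp only [nsmul_eq_mul, mul_one, ENNReal.coe_natCast]
  exact ENNReal.inv_mul_cancel (by exact_mod_cast h) (ENNReal.natCast_ne_top _)

theorem ae_nonneg_nonzeroSpectralDistribution (hA : A.IsHermitian)
    (h : ∀ i, 0 ≤ hA.eigenvalues i) :
    ∀ᵐ y ∂(nonzeroSpectralDistribution hA : Measure ℝ), 0 ≤ y := by
  rw [toMeasure_nonzeroSpectralDistribution]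
  refine Measure.ae_smul_measure ?_ _
  rw [ae_finsetSum_measure_iff]
  intro i _
  rw [ae_dirac_iff measurableSet_Ici]
  exact h i

theorem sum_nonzero_inv_add (hA : A.IsHermitian) {t : ℝ} :
    ∑ i with hA.eigenvalues i ≠ 0, (hA.eigenvalues i + t)⁻¹ =
      ∑ i, (hA.eigenvalues i + t)⁻¹ - (Fintype.card ι - A.rank : ℝ) / t := by
  have h := Finset.sum_filter_add_sum_filter_not Finset.univ
    (fun i => hA.eigenvalues i ≠ 0) fun i => (hA.eigenvalues i + t)⁻¹
  have hc := Finset.card_filter_add_card_filter_not (s := (Finset.univ : Finset ι))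
    fun i => hA.eigenvalues i ≠ 0
  rw [card_filter_eigenvalues_ne_zero] at hc
  have h0 : ∑ i with ¬ hA.eigenvalues i ≠ 0, (hA.eigenvalues i + t)⁻¹ =
      (Fintype.card ι - A.rank : ℝ) / t := by
    rw [Finset.sum_congr rfl (g := fun _ => t⁻¹)]
    · rw [Finset.sum_const, nsmul_eq_mul, div_eq_mul_inv, ← Finset.card_univ, ← hc]
      push_cast
      ring
    · intro i hi
      rw [not_not.1 (Finset.mem_filter.1 hi).2, zero_add]
  rw [← h, h0]
  ring

end NonzeroSpectrum

/-! ### Rank and resolvent trace of the random matrices. -/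

section SumOfProjectors

variable {p d k : ℕ} (u : Fin p → Fin k → EuclideanSpace ℂ (Fin d))

theorem sumOfProjectors_eq_mul_conjTranspose :
    sumOfProjectors u = (Matrix.of fun j s => productVector (u s) j) *
      (Matrix.of fun j s => productVector (u s) j).conjTranspose := by
  ext i j
  simp [sumOfProjectors, Matrix.sum_apply, Matrix.vecMulVec_apply, Matrix.mul_apply]

theorem rank_sumOfProjectors_le : (sumOfProjectors u).rank ≤ p := by
  rw [sumOfProjectors_eq_mul_conjTranspose]
  exact (Matrix.rank_mul_le_left _ _).trans ((Matrix.rank_le_card_width _).trans_eq (Fintype.card_fin p))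

open scoped ComplexOrder in
theorem eigenvalues_sumOfProjectors_nonneg (i : Fin k → Fin d) :
    0 ≤ (sumOfProjectors_isHermitian u).eigenvalues i := by
  refine Matrix.PosSemidef.eigenvalues_nonneg (A := sumOfProjectors u) ?_ i
  rw [sumOfProjectors_eq_mul_conjTranspose]
  exact Matrix.posSemidef_self_mul_conjTranspose _

theorem stieltjes_productVector_eq_sum {t : ℝ} (ht : 0 < t) :
    stieltjes (fun s => productVector (u s)) t =
      (∑ i, ((sumOfProjectors_isHermitian u).eigenvalues i + t)⁻¹) /
        Fintype.card (Fin k → Fin d) := by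
  rw [← trace_inv_add_smul_one _ fun i =>
    (add_pos_of_nonneg_of_pos (eigenvalues_sumOfProjectors_nonneg u i) ht).ne']
  rfl

theorem rank_div_card_le_one :
    ((sumOfProjectors u).rank / Fintype.card (Fin k → Fin d) : ℝ) ≤ 1 := by
  refine div_le_one_of_le₀ ?_ (Nat.cast_nonneg _)
  exact_mod_cast Matrix.rank_le_card_width _

variable [Nonempty (Fin k → Fin d)]

theorem integral_inv_add_sumOfProjectors {t : ℝ} (ht : 0 < t) :
    ∫ y, (y + t)⁻¹
        ∂(nonzeroSpectralDistribution (sumOfProjectors_isHermitian u) : Measure ℝ) =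
      ((sumOfProjectors u).rank / Fintype.card (Fin k → Fin d) : ℝ)⁻¹ *
        (stieltjes (fun s => productVector (u s)) t -
          (1 - (sumOfProjectors u).rank / Fintype.card (Fin k → Fin d)) / t) := by
  have hN : (Fintype.card (Fin k → Fin d) : ℝ) ≠ 0 := by
    exact_mod_cast Fintype.card_ne_zero
  rw [integral_nonzeroSpectralDistribution, sum_nonzero_inv_add,
    stieltjes_productVector_eq_sum u ht]
  generalize (Fintype.card (Fin k → Fin d) : ℝ) = N at *
  rw [inv_div, div_eq_mul_inv N, mul_comm N, mul_assoc]
  congr 1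
  field_simp

/-- Among the nonnegative terms of the resolvent trace, the zero eigenvalues alone contribute `(1 -
rank / N) / t`. -/
theorem one_sub_rank_div_card_le {t : ℝ} (ht : 0 < t) :
    1 - ((sumOfProjectors u).rank / Fintype.card (Fin k → Fin d) : ℝ) ≤
      t * stieltjes (fun s => productVector (u s)) t := by
  have h0 : 0 ≤ ∑ i with (sumOfProjectors_isHermitian u).eigenvalues i ≠ 0,
      ((sumOfProjectors_isHermitian u).eigenvalues i + t)⁻¹ :=
    Finset.sum_nonneg fun i _ =>
      inv_nonneg.2 (add_nonneg (eigenvalues_sumOfProjectors_nonneg u i) ht.le)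
  have hN : (0 : ℝ) < Fintype.card (Fin k → Fin d) := by exact_mod_cast Fintype.card_pos
  rw [sum_nonzero_inv_add, sub_nonneg, div_le_iff₀ ht] at h0
  rw [stieltjes_productVector_eq_sum u ht, mul_div_assoc', le_div_iff₀ hN, sub_mul,
    div_mul_cancel₀ _ hN.ne', one_mul, mul_comm t]
  exact h0

end SumOfProjectors

/-! ### The limiting rank. -/

section RankLimit

/-- The product `t * mpStieltjes x t` extends continuously to `t = 0`, with value `(|x - 1| - (x -
1)) / 2 = 1 - min x 1`, the mass of the atom. -/
theorem exists_rat_mul_mpStieltjes_lt {x b : ℝ} (hb : 1 - min x 1 < b) :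
    ∃ t : ℚ, 0 < t ∧ t * mpStieltjes x t < b := by
  let g : ℝ → ℝ := fun t => (√((t + x - 1) ^ 2 + 4 * t) - (t + x - 1)) / 2
  have hg : Continuous g := by fun_prop
  have hg0 : g 0 = 1 - min x 1 := by
    simp only [g, zero_add, mul_zero, add_zero, Real.sqrt_sq_eq_abs]
    rcases le_total x 1 with h | h
    · rw [min_eq_left h, abs_of_nonpos (by linarith)]; ring
    · rw [min_eq_right h, abs_of_nonneg (by linarith)]; ring
  have h : ∀ᶠ t in 𝓝 (0 : ℝ), g t < b :=
    hg.continuousAt.eventually_lt continuousAt_const (hg0 ▸ hb)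
  obtain ⟨ε, hε, h⟩ := Metric.eventually_nhds_iff.1 h
  obtain ⟨t, ht0, htε⟩ := exists_rat_btwn hε
  have ht : (0 : ℝ) < t := by simpa using ht0
  refine ⟨t, by exact_mod_cast ht, ?_⟩
  have hgt : (t : ℝ) * mpStieltjes x t = g t := by
    simp only [g, mpStieltjes]
    field_simp
  rw [hgt]
  exact h (by rwa [Real.dist_eq, sub_zero, abs_of_pos ht])

/-- The upper bound on the rank is linear algebra; the lower bound comes from the transform at small
`t`. No almost sure linear independence of product vectors is required. -/
theorem tendsto_min_of_one_sub_le {x : ℝ} {r a : ℕ → ℝ} {s : ℕ → ℝ → ℝ}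
    (ha : Tendsto a atTop (𝓝 x)) (hra : ∀ n, r n ≤ a n) (hr : ∀ n, r n ≤ 1)
    (hs : ∀ t : ℚ, 0 < t → Tendsto (fun n => s n t) atTop (𝓝 (mpStieltjes x t)))
    (h : ∀ n (t : ℚ), 0 < t → 1 - r n ≤ t * s n t) :
    Tendsto r atTop (𝓝 (min x 1)) := by
  refine tendsto_order.2 ⟨fun c hc => ?_, fun c hc => ?_⟩
  · obtain ⟨t, ht, htc⟩ := exists_rat_mul_mpStieltjes_lt (b := 1 - c) (sub_lt_sub_left hc 1)
    filter_upwards [((hs t ht).const_mul (t : ℝ)).eventually_lt_const htc] with n hn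
    linarith [h n t ht]
  · filter_upwards [(ha.min (tendsto_const_nhds (x := (1 : ℝ)))).eventually_lt_const hc]
      with n hn
    exact (le_min (hra n) (hr n)).trans_lt hn

end RankLimit

/-! ### Weak convergence for a fixed sequence of matrices. -/

section Deterministic

theorem tendsto_nonzeroSpectralDistribution {x : ℝ} (hx : 0 < x) {k : ℕ} {d p : ℕ → ℕ}
    [∀ n, Nonempty (Fin k → Fin (d n))]
    (hp : Tendsto (fun n => (p n : ℝ) / Fintype.card (Fin k → Fin (d n))) atTop (𝓝 x))
    (u : ∀ n, Fin (p n) → Fin k → EuclideanSpace ℂ (Fin (d n)))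
    (h : ∀ t : ℚ, 0 < t → Tendsto (fun n => stieltjes (fun s => productVector (u n s)) t) atTop
      (𝓝 (mpStieltjes x t))) :
    Tendsto (fun n => nonzeroSpectralDistribution (sumOfProjectors_isHermitian (u n))) atTop
      (𝓝 (marchenkoPasturLaw x)) := by
  have hmin : 0 < min x 1 := lt_min hx one_pos
  have hr : Tendsto (fun n => ((sumOfProjectors (u n)).rank /
      Fintype.card (Fin k → Fin (d n)) : ℝ)) atTop (𝓝 (min x 1)) := by
    refine tendsto_min_of_one_sub_le hp (fun n => ?_) (fun n => rank_div_card_le_one (u n)) h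
      fun n t ht => one_sub_rank_div_card_le (u n) (by exact_mod_cast ht)
    gcongr
    exact rank_sumOfProjectors_le (u n)
  obtain ⟨m, hm⟩ := eventually_atTop.1 (hr.eventually_const_lt hmin)
  rw [FiniteMeasure.tendsto_iff_forall_integral_tendsto]
  intro f
  -- Discarding the first `m` matrices makes every rank positive, so that each remaining spectral
  -- distribution is a probability measure.
  rw [← tendsto_add_atTop_iff_nat m]
  have hprob (n : ℕ) : IsProbabilityMeasure
      (nonzeroSpectralDistribution (sumOfProjectors_isHermitian (u (n + m))) : Measure ℝ) := by
    refine isProbabilityMeasure_nonzeroSpectralDistribution _ fun h0 => ?_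
    have := hm (n + m) (Nat.le_add_left m n)
    rw [h0] at this
    simp at this
  have := isProbabilityMeasure_marchenkoPasturLaw hx
  refine tendsto_integral_of_tendsto_stieltjes
    (fun n => ae_nonneg_nonzeroSpectralDistribution _ (eigenvalues_sumOfProjectors_nonneg _))
    ae_nonneg_marchenkoPasturLaw (fun t ht => ?_) f
  have ht' : (0 : ℝ) < t := by exact_mod_cast ht
  rw [integral_inv_add_marchenkoPasturLaw hx ht']
  simp only [integral_inv_add_sumOfProjectors _ ht']
  exact (tendsto_add_atTop_iff_nat m).2
    ((hr.inv₀ hmin.ne').mul ((h t ht).sub ((hr.const_sub 1).div_const _)))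

end Deterministic

/-! ### Joint law of the product vectors. -/

section JointLaw

theorem map_productVector_eq_pi {p d k : ℕ} {P : Measure (EuclideanSpace ℂ (Fin d))}
    [IsProbabilityMeasure P] {Ω : Type*} [MeasurableSpace Ω] {μ : Measure Ω}
    [IsProbabilityMeasure μ] {φ : Fin p → Fin k → Ω → EuclideanSpace ℂ (Fin d)}
    (hlaw : ∀ s a, HasLaw (φ s a) P μ)
    (hindep : iIndepFun (fun (q : Fin p × Fin k) => φ q.1 q.2) μ) :
    μ.map (fun ω s => productVector fun a => φ s a ω) =
      Measure.pi fun _ => productLaw P k := by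
  have hmeas (s : Fin p) (a : Fin k) : AEMeasurable (φ s a) μ := (hlaw s a).aemeasurable
  have h1 := (iIndepFun_iff_map_fun_eq_pi_map fun q : Fin p × Fin k => hmeas q.1 q.2).1 hindep
  simp only [fun q : Fin p × Fin k => (hlaw q.1 q.2).map_eq] at h1
  -- Independence is given over pairs `(s, a)`; currying regroups the product measure into
  -- independent blocks of `k` factors.
  have h2 : μ.map (fun ω s a => φ s a ω) =
      Measure.pi fun _ : Fin p => Measure.pi fun _ : Fin k => P := by
    have h3 := Measure.infinitePi_map_curry (X := EuclideanSpace ℂ (Fin d))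
      (fun (_ : Fin p) (_ : Fin k) => P)
    simp only [Measure.infinitePi_eq_pi] at h3
    have h5 : AEMeasurable (fun ω (q : Fin p × Fin k) => φ q.1 q.2 ω) μ :=
      aemeasurable_pi_lambda _ fun q => hmeas q.1 q.2
    rw [← h3, ← h1, AEMeasurable.map_map_of_aemeasurable
      (MeasurableEquiv.measurable _).aemeasurable h5]
    rfl
  have hpv : Measurable (productVector : (Fin k → EuclideanSpace ℂ (Fin d)) → _) :=
    continuous_productVector.measurable
  have : IsProbabilityMeasure (productLaw P k) :=
    Measure.isProbabilityMeasure_map hpv.aemeasurable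
  have h4 := Measure.pi_map_pi (μ := fun _ : Fin p => Measure.pi fun _ : Fin k => P)
    (f := fun _ => productVector) (fun _ => hpv.aemeasurable)
    (hμ := fun _ => inferInstanceAs (SigmaFinite (productLaw P k)))
  have h6 : Measurable fun (y : Fin p → Fin k → EuclideanSpace ℂ (Fin d)) s =>
      productVector (y s) :=
    measurable_pi_lambda _ fun s => hpv.comp (measurable_pi_apply s)
  rw [← h2, AEMeasurable.map_map_of_aemeasurable h6.aemeasurable
    (aemeasurable_pi_lambda _ fun s => aemeasurable_pi_lambda _ fun a => hmeas s a)] at h4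
  exact h4

end JointLaw

end RandomProductStates
end

/-! ### Assembly of the main theorem. -/

theorem mainTheorem3 (e : RandomProductStates.Ensemble) (k : ℕ) (hk : 1 ≤ k)
    (x : ℝ) (hx : 0 < x)
    (d p : ℕ → ℕ) (hd : StrictMono d) (hd1 : ∀ n, 1 ≤ d n)
    (hp : Tendsto (fun n => (p n : ℝ) / (d n : ℝ) ^ k) atTop (𝓝 x))
    {Ω : Type*} [MeasurableSpace Ω] (μ : Measure Ω) [IsProbabilityMeasure μ]
    (φ : (n : ℕ) → Fin (p n) → Fin k → Ω → EuclideanSpace ℂ (Fin (d n)))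
    (hlaw : ∀ n s a, HasLaw (φ n s a) (e.factorLaw (d n)) μ)
    (hindep : ∀ n, iIndepFun (fun (q : Fin (p n) × Fin k) => φ n q.1 q.2) μ) :
    ∀ᵐ ω ∂μ, Tendsto
      (fun n => RandomProductStates.nonzeroSpectralDistribution
        (RandomProductStates.sumOfProjectors_isHermitian (fun s a => φ n s a ω)))
      atTop (𝓝 (RandomProductStates.marchenkoPasturLaw x)) := by
  open RandomProductStates in
  have hne (n : ℕ) : Nonempty (Fin (d n)) := ⟨⟨0, hd1 n⟩⟩
  have hcard (n : ℕ) : Fintype.card (Fin k → Fin (d n)) = d n ^ k := by simp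
  have hp' : Tendsto (fun n => (p n : ℝ) / Fintype.card (Fin k → Fin (d n))) atTop (𝓝 x) := by
    simpa only [hcard, Nat.cast_pow] using hp
  -- The factor moment bounds are available for `d n ≥ 2`; the finitely many other indices do not
  -- affect the limit.
  have hd2 : ∀ᶠ n in atTop, 2 ≤ d n := hd.tendsto_atTop.eventually_ge_atTop 2
  have hdinv : Tendsto (fun n => varianceConstant k / d n) atTop (𝓝 0) :=
    (tendsto_natCast_atTop_atTop.comp hd.tendsto_atTop).const_div_atTop _
  have hmeas (n : ℕ) : AEMeasurable (fun ω s => productVector fun a => φ n s a ω) μ :=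
    aemeasurable_pi_lambda _ fun s => continuous_productVector.measurable.comp_aemeasurable
      (aemeasurable_pi_lambda _ fun a => (hlaw n s a).aemeasurable)
  -- Restricting to rational `t` makes one null set serve for all of them.
  have hst : ∀ᵐ ω ∂μ, ∀ t : ℚ, 0 < t → Tendsto
      (fun n => stieltjes (fun s => productVector fun a => φ n s a ω) t) atTop
      (𝓝 (mpStieltjes x t)) := by
    refine ae_all_iff.2 fun t => ?_
    by_cases ht : 0 < t
    · filter_upwards [ae_tendsto_stieltjes (Q := fun n => productLaw (e.factorLaw (d n)) k) hx
        -- The dimension dominates the index: `n ≤ d n` by strict monotonicity, and `d n ≤ d n ^ k`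
        -- because `k ≥ 1`.
        (fun n => (hd.le_apply).trans ((Nat.le_self_pow (by omega) _).trans_eq (hcard n).symm)) hp'
        (fun n => div_nonneg (varianceConstant_nonneg k) (Nat.cast_nonneg _)) hdinv
        (hd2.mono fun n hn =>
          quadraticConcentration_productLaw (hd1 n) (factorLaw_ensemble e hn) k)
        hmeas
        (hd2.mono fun n hn => by
          have := (factorLaw_ensemble e hn).isProbabilityMeasure
          exact map_productVector_eq_pi (hlaw n) (hindep n))
        (t := t) (by exact_mod_cast ht)] with ω hω _ using hω
    · exact ae_of_all _ fun ω h => absurd h ht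
  filter_upwards [hst] with ω hω
  exact tendsto_nonzeroSpectralDistribution hx hp' (fun n s a => φ n s a ω) hω
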